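/- **Setting.** Write $e(x)=e^{2\pi i x}$ and let $\|x\|$ be the distance from $x\in\mathbb R$ to the nearest integer. Fix the implied constants in the hypotheses below (written $\ll$, $\asymp$, and $t_0$, which is sufficiently large in terms of them). Let $N,k\ge1$ and $s\ge2$ be integers, and let $t\ge\max\{k^{3/2}\log k,\,N^{3/2},\,t_0\}$. Put $\mathcal C=\frac{N}{\pi^2}\left|\frac{k+1}2+it\right|\left|\frac{k+3}2+it\right|$. Let $M_0\in[2,\sqrt{\mathcal C}]$ be an integer with $(t/\log t)^{2/3}\ll M_0\ll t^{2/3}$, let $M$ be a real number with $M_0\le M\ll\sqrt{\mathcal C}$, put $R=\sqrt{M/M_0}$ and $H=\lceil M^2/(R^2t)\rceil$, and let $M_1,M_2$ be integers with $M\ll M_1\le M_2\le 2M_1\ll M$ and $M_2-M_1\ge 4H$. Let $\alpha_1<\dots<\alpha_J$ be the rational numbers with reduced denominator at most $R$ in $\left[-\frac{t}{2\pi(M_1+2H)},-\frac{t}{2\pi(M_2-2H)}\right]$, and write $\alpha_j=-u_j/v_j$ in lowest terms with $u_j,v_j>0$. Put $\rho_j=-\frac{u_j+u_{j+1}}{v_j+v_{j+1}}$,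 $\mathcal N_0=M_1+2H$, $\mathcal N_J=M_2-2H$, $\mathcal N_j=\left\lfloor-\frac{t}{2\pi\rho_j}+\frac12\right\rfloor$ for $0<j<J$, and $\omega_j(x)=\omega(x-\mathcal N_{j-1})-\omega(x-\mathcal N_j)$, where $\omega(x)=1$ for $x\ge H$, $\omega(x)=0$ for $x\le -H$ and $\omega(x)=\frac12\left(1+\sin^{s+1}\frac{\pi x}{2H}\right)$ for $-H<x<H$. Let $N^\flat=N\prod_{p\mid N}p^{-1}$. Let $d_j$ be the product of the $p^{\mathrm{ord}_p(v_j)}$ over the primes $p\mid v_j$ with $\mathrm{ord}_p(v_j)<\mathrm{ord}_p(N)$, let $q_j=v_j/d_j$, let $c_j\in[0,d_j)$ be the integer with $q_jc_j\equiv-u_j\pmod{d_j}$, let $\beta_j=c_j/d_j$, and let $a_j$ be the integer with $\frac{a_j}{q_j}=\frac{u_j}{v_j}+\beta_j$. For both choices of the sign $\pm$ put $$x_j^\pm(y)=\left(\tfrac{d_j}{2u_j}\right)^2\left(\sqrt{y+\tfrac{2tu_jq_j}{\pi d_j}}\pm\sqrt y\right)^2,\qquad h_j^\pm(y)=\left(\frac{q_jt\sqrt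 y}{\pi x_j^\pm(y)^{3/2}}\pm\frac{y}{x_j^\pm(y)}\right)^{-1/2},$$ $$g_j^\pm(y)=-\frac t{2\pi}\log x_j^\pm(y)+\frac{u_j}{v_j}x_j^\pm(y)\mp\frac2{q_j}\sqrt{y\,x_j^\pm(y)}+\frac18\mp\frac18 .$$ Fix $\beta=\frac cd\in\{b/N^\flat:0\le b<N^\flat\}$ in lowest terms ($d\ge1$) and $r\mid NN^\flat$, and let $J(\beta,r)=\{1\le j\le J:\beta_j=\beta,\ (q_j,r)=1\}$. For an integer $m$ prime to $q_j$, $\overline m$ denotes an inverse of $m$ modulo $q_j$. **Proposition (Large Sieve).** Let $L_1,L_2,U_1,U_2,V_1,V_2$ be positive integers with $L\ll L_1\le L_2\le L$, $U\ll U_1\le U_2\le U$, $V\ll V_1\le V_2\le V$, where $L\ll\frac{rM}{(dR)^2}$, $V\ll R$ and $U\asymp\frac{tV}{M}$. Put $$\mathcal R=\{(u,v)\in\mathbb Z^2:U_1\le u\le U_2,\ V_1\le v\le V_2,\ (u,v)=1,\ du\equiv-cv\!\!\pmod{d^2}\},$$ $$\eta=\sqrt{\frac{d^2t}{rLUV}},\qquad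 X_0=\sqrt{L\max(\eta,1)}.$$ Then there are functions $\Delta_1,\Delta_2\ge0$ on $(0,\infty)$ with $\Delta_1(X)\ll\frac L{X^2}$ and $\Delta_2(X)\ll\frac{L}{\eta X^2}$ such that, for both signs $\pm$ and all complex numbers $\nu(j)$ ($j\in J(\beta,r)$) and $\lambda(\ell)$ ($L_1\le\ell\le L_2$), $$\left|\sum_{\ell=L_1}^{L_2}\lambda(\ell)\sum_{\substack{j\in J(\beta,r)\\(u_j,v_j)\in\mathcal R}}\nu(j)\,e\!\left(\frac{\overline{ra_j}\,\ell}{q_j}\right)h_j^\pm(\ell/r)\,\omega_j\big(x_j^\pm(\ell/r)\big)\,e\big(g_j^\pm(\ell/r)\big)\right|^2$$ $$\ll\max_{j\in J(\beta,r)}|\nu(j)|^2\sum_{\ell=L_1}^{L_2}|\lambda(\ell)|^2\cdot\frac{\eta rV}{U}\left\{X_0(\#\mathcal R)^2+\int_{X_0}^LB\big(\Delta_1(X),\Delta_2(X)\big)\,dX\right\}.$$ Here $B(\Delta_1,\Delta_2)$ is the number of pairs $(i,j)\in J(\beta,r)^2$ with $(u_i,v_i),(u_j,v_j)\in\mathcal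 R$, $$\left\|\frac{\overline{a_ir}}{q_i}-\frac{\overline{a_jr}}{q_j}\right\|\le\Delta_1\quad\text{and}\quad|u_iv_i-u_jv_j|\le UV\Delta_2 ,$$ and the implied constants in the three conclusions depend only on the implied constants in the hypotheses; in particular they do not depend on $N,k,s,t,M_0,M,M_1,M_2,\beta,r,L,U,V$, the integers $L_i,U_i,V_i$, $\nu$ or $\lambda$. -/

import Mathlib

noncomputable section

namespace FareySieve

/-- The additive character `e(x) = exp(2πix)`. -/
def e (x : ℝ) : ℂ := Complex.exp (2 * Real.pi * Complex.I * x)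

/-- Distance from `x` to the nearest integer. -/
def distInt (x : ℝ) : ℝ := |x - round x|

/-- `N^♭ = N ∏_{p ∣ N} p⁻¹` (the division is exact). -/
def flat (N : ℕ) : ℕ := N / ∏ p ∈ N.primeFactors, p

/-- The fractions `b / N^♭` with `0 ≤ b < N^♭`. -/
def badFractions (N : ℕ) : Set ℚ := {β | ∃ b : ℕ, b < flat N ∧ β = (b : ℚ) / (flat N : ℚ)}

/-- The free parameters: level `N`, weight `k`, height `t`, the integer `M₀`, the size parameter `M`,
the end points `M₁, M₂` of the summation interval and the exponent `s` of the weight function. -/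
structure Setup where
  N : ℕ
  k : ℕ
  t : ℝ
  M₀ : ℕ
  M : ℝ
  M₁ : ℕ
  M₂ : ℕ
  s : ℕ

namespace Setup

variable (P : Setup)

/-- The analytic conductor `(N / π²) |(k+1)/2 + it| |(k+3)/2 + it|`. -/
def conductor : ℝ :=
  (P.N : ℝ) / Real.pi ^ 2 * ‖((P.k : ℂ) + 1) / 2 + Complex.I * P.t‖
    * ‖((P.k : ℂ) + 3) / 2 + Complex.I * P.t‖

/-- `R = √(M / M₀)`. -/
def R : ℝ := √(P.M / P.M₀)

/-- `H = ⌈M² / (R² t)⌉`. -/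
def H : ℕ := ⌈P.M ^ 2 / (P.R ^ 2 * P.t)⌉₊

/-- The standing assumptions on the parameters. The real number `c` serves for all implied
constants in `≪` and `≍`, and `t₀` is the lower bound that makes `t` large. -/
structure Standing (c t₀ : ℝ) : Prop where
  N_pos : 1 ≤ P.N
  k_pos : 1 ≤ P.k
  two_le_s : 2 ≤ P.s
  t_ge_k : (P.k : ℝ) ^ (3 / 2 : ℝ) * Real.log P.k ≤ P.t
  t_ge_N : (P.N : ℝ) ^ (3 / 2 : ℝ) ≤ P.t
  t_ge : t₀ ≤ P.t
  two_le_M₀ : 2 ≤ P.M₀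
  M₀_le_sqrt : (P.M₀ : ℝ) ≤ √P.conductor
  M₀_lower : (P.t / Real.log P.t) ^ (2 / 3 : ℝ) ≤ c * P.M₀
  M₀_upper : (P.M₀ : ℝ) ≤ c * P.t ^ (2 / 3 : ℝ)
  M₀_le_M : (P.M₀ : ℝ) ≤ P.M
  M_le_sqrt : P.M ≤ c * √P.conductor
  M_le_M₁ : P.M ≤ c * P.M₁
  M₁_le_M₂ : P.M₁ ≤ P.M₂
  M₂_le : P.M₂ ≤ 2 * P.M₁
  M₁_le_M : 2 * (P.M₁ : ℝ) ≤ c * P.M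
  length : P.M₁ + 4 * P.H ≤ P.M₂

/-- The fractions with reduced denominator at most `R` in the interval
`[-t / (2π(M₁ + 2H)), -t / (2π(M₂ - 2H))]`. -/
def fareySet : Set ℚ :=
  {α | (α.den : ℝ) ≤ P.R ∧
    -P.t / (2 * Real.pi * ((P.M₁ : ℝ) + 2 * P.H)) ≤ (α : ℝ) ∧
    (α : ℝ) ≤ -P.t / (2 * Real.pi * ((P.M₂ : ℝ) - 2 * P.H))}

theorem fareySet_finite : P.fareySet.Finite := by
  set lo := -P.t / (2 * Real.pi * ((P.M₁ : ℝ) + 2 * P.H)) with hlo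
  set hi := -P.t / (2 * Real.pi * ((P.M₂ : ℝ) - 2 * P.H)) with hhi
  let S : Set (ℤ × ℕ) := Set.Icc (⌊-(|lo| * |P.R|)⌋) (⌈|hi| * |P.R|⌉) ×ˢ Set.Iic ⌊P.R⌋₊
  have hS : S.Finite := (Set.finite_Icc _ _).prod (Set.finite_Iic _)
  refine (hS.image fun x => (x.1 : ℚ) / (x.2 : ℚ)).subset ?_
  rintro α ⟨h1, h2, h3⟩
  have hd : (0 : ℝ) < α.den := by exact_mod_cast α.den_pos
  have hnum : (α.num : ℝ) = (α : ℝ) * α.den := by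
    have := Rat.mul_den_eq_num α
    exact_mod_cast this.symm
  have hR : (α.den : ℝ) ≤ |P.R| := h1.trans (le_abs_self _)
  refine ⟨(α.num, α.den), ⟨⟨?_, ?_⟩, ?_⟩, Rat.num_div_den α⟩
  · have : (-(|lo| * |P.R|) : ℝ) ≤ (α.num : ℝ) := by
      rw [hnum]
      have h4 : -|lo| ≤ (α : ℝ) := (neg_abs_le lo).trans h2
      have h5 : |lo| * α.den ≤ |lo| * |P.R| := mul_le_mul_of_nonneg_left hR (abs_nonneg _)
      nlinarith
    exact_mod_cast (Int.floor_le _).trans this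
  · have : (α.num : ℝ) ≤ |hi| * |P.R| := by
      rw [hnum]
      have h4 : (α : ℝ) ≤ |hi| := h3.trans (le_abs_self hi)
      have h5 : |hi| * α.den ≤ |hi| * |P.R| := mul_le_mul_of_nonneg_left hR (abs_nonneg _)
      nlinarith
    exact_mod_cast this.trans (Int.le_ceil _)
  · exact Nat.le_floor h1

/-- The number `J` of these fractions. -/
def J : ℕ := P.fareySet_finite.toFinset.card

/-- `α_j`, `1 ≤ j ≤ J`: the fractions in increasing order. -/
def α (j : ℕ) : ℚ := (P.fareySet_finite.toFinset.sort (· ≤ ·)).getD (j - 1) 0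

/-- `α_j = -u_j / v_j` in lowest terms. -/
def u (j : ℕ) : ℤ := -(P.α j).num

def v (j : ℕ) : ℕ := (P.α j).den

/-- The mediant `ρ_j` of `α_j` and `α_{j+1}`. -/
def ρ (j : ℕ) : ℝ := -((P.u j : ℝ) + P.u (j + 1)) / ((P.v j : ℝ) + P.v (j + 1))

/-- The integers `𝒩_j`, `0 ≤ j ≤ J`: `𝒩_0 = M₁ + 2H`, `𝒩_J = M₂ - 2H`, and the integer nearest to
`-t / (2πρ_j)` otherwise. -/
def cut (j : ℕ) : ℤ :=
  if j = 0 then (P.M₁ : ℤ) + 2 * P.H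
  else if j = P.J then (P.M₂ : ℤ) - 2 * P.H
  else ⌊-P.t / (2 * Real.pi * P.ρ j) + 1 / 2⌋

/-- The smooth step from `0` to `1` on `[-H, H]`. -/
def step (x : ℝ) : ℝ :=
  if (P.H : ℝ) ≤ x then 1
  else if x ≤ -(P.H : ℝ) then 0
  else (1 + Real.sin (Real.pi * x / (2 * P.H)) ^ (P.s + 1)) / 2

/-- The weight `ω_j(x) = ω(x - 𝒩_{j-1}) - ω(x - 𝒩_j)`. -/
def ω (j : ℕ) (x : ℝ) : ℝ := P.step (x - P.cut (j - 1)) - P.step (x - P.cut j)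

/-- The part `d_j` of `v_j` supported on the primes with `0 < ord_p v_j < ord_p N`. -/
def d (j : ℕ) : ℕ :=
  ∏ p ∈ (P.v j).primeFactors with (P.v j).factorization p < P.N.factorization p,
    p ^ (P.v j).factorization p

def q (j : ℕ) : ℕ := P.v j / P.d j

/-- The integer `c_j ∈ [0, d_j)` with `q_j c_j ≡ -u_j (mod d_j)`. -/
def c (j : ℕ) : ℕ := (-(P.u j : ZMod (P.d j)) * (P.q j : ZMod (P.d j))⁻¹).val

/-- The integer `a_j` with `a_j / q_j = u_j / v_j + c_j / d_j` (the division is exact). -/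
def a (j : ℕ) : ℤ := (P.u j + P.c j * P.q j) / P.d j

/-- `β_j = c_j / d_j`. -/
def β (j : ℕ) : ℚ := (P.c j : ℚ) / P.d j

/-- `J(β, r)`: the indices `1 ≤ j ≤ J` with `β_j = β` and `(q_j, r) = 1`. -/
def idx (b : ℚ) (r : ℕ) : Finset ℕ :=
  {j ∈ Finset.Icc 1 P.J | P.β j = b ∧ (P.q j).Coprime r}

/-- The fraction `\overline{r a_j} / q_j`, where the inverse of `r a_j` is taken modulo `q_j`. -/
def invFrac (r j : ℕ) : ℝ := ((((r : ZMod (P.q j)) * (P.a j : ZMod (P.q j)))⁻¹).val : ℝ) / P.q j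

/-- The stationary point `x_j^±(y)`; the sign is `σ = ±1`, here and in the next two definitions. -/
def x (σ : ℝ) (j : ℕ) (y : ℝ) : ℝ :=
  ((P.d j : ℝ) / (2 * P.u j)) ^ 2
    * (√(y + 2 * P.t * P.u j * P.q j / (Real.pi * P.d j)) + σ * √y) ^ 2

/-- The phase `g_j^±(y)`. -/
def g (σ : ℝ) (j : ℕ) (y : ℝ) : ℝ :=
  -P.t / (2 * Real.pi) * Real.log (P.x σ j y) + (P.u j : ℝ) / P.v j * P.x σ j y
    - σ * (2 / P.q j * √(y * P.x σ j y)) + 1 / 8 - σ * (1 / 8)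

/-- The amplitude `h_j^±(y)`. -/
def h (σ : ℝ) (j : ℕ) (y : ℝ) : ℝ :=
  (P.q j * P.t * √y / (Real.pi * P.x σ j y ^ (3 / 2 : ℝ)) + σ * (y / P.x σ j y)) ^ (-(1 / 2) : ℝ)

end Setup

/-- The set `ℛ` of pairs `(u, v)` of coprime integers with `U₁ ≤ u ≤ U₂`, `V₁ ≤ v ≤ V₂` and
`d u ≡ -c v (mod d²)`, where `b = c / d` in lowest terms. -/
def pairs (b : ℚ) (U₁ U₂ V₁ V₂ : ℕ) : Finset (ℤ × ℤ) :=
  {w ∈ Finset.Icc (U₁ : ℤ) U₂ ×ˢ Finset.Icc (V₁ : ℤ) V₂ |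
    IsCoprime w.1 w.2 ∧ (b.den : ℤ) * w.1 ≡ -b.num * w.2 [ZMOD (b.den : ℤ) ^ 2]}

/-- The indices `j ∈ J(β, r)` with `(u_j, v_j) ∈ ℛ`. -/
def idxIn (P : Setup) (b : ℚ) (r U₁ U₂ V₁ V₂ : ℕ) : Finset ℕ :=
  {j ∈ P.idx b r | (P.u j, (P.v j : ℤ)) ∈ pairs b U₁ U₂ V₁ V₂}

open Classical in
/-- The number `B(Δ₁, Δ₂)` of pairs `(i, j)` of indices in `J(β, r)` with
`(u_i, v_i), (u_j, v_j) ∈ ℛ`, `‖\overline{a_i r}/q_i - \overline{a_j r}/q_j‖ ≤ Δ₁` and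
`|u_i v_i - u_j v_j| ≤ U V Δ₂`. -/
def pairCount (P : Setup) (b : ℚ) (r U₁ U₂ V₁ V₂ : ℕ) (U V Δ₁ Δ₂ : ℝ) : ℕ :=
  Finset.card {w ∈ idxIn P b r U₁ U₂ V₁ V₂ ×ˢ idxIn P b r U₁ U₂ V₁ V₂ |
    distInt (P.invFrac r w.1 - P.invFrac r w.2) ≤ Δ₁ ∧
    |(P.u w.1 : ℝ) * P.v w.1 - (P.u w.2 : ℝ) * P.v w.2| ≤ U * V * Δ₂}

/-- `η = √(d² t / (r L U V))`, with `d` the denominator of `b`. -/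
def eta (P : Setup) (b : ℚ) (r : ℕ) (L U V : ℝ) : ℝ :=
  √((b.den : ℝ) ^ 2 * P.t / (r * L * U * V))

/-- `X₀ = √(L max(η, 1))`. -/
def cutoff (P : Setup) (b : ℚ) (r : ℕ) (L U V : ℝ) : ℝ :=
  √(L * max (eta P b r L U V) 1)

end FareySieve

end

noncomputable section

namespace FareySieve

/-! Cauchy's inequality over `ℓ`, followed by opening the square, reduces the claim to a bound, for
each pair `(i, j)`, of a sum over `ℓ` with weights `h_i ω_i h_j ω_j` and phase `θ ℓ + g_i(ℓ/r) -
g_j(ℓ/r)`, where `θ` is the difference of the two fractions with inverted numerators.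

The weights are built from boundedly many monotone functions of `ℓ`, so partial summation removes
them at the cost of a constant times their size. Since `h_j` is of order at most `√(η r V / U)`,
this produces the factor `η r V / U` (`IsMultiplier`, `isMultiplier_weight`).

For the phase, put `κ = u q / d = u v / d²` and `s = √(1 + b κ / z)`. The derivative of `g_j` is
then `-σ (s + σ) / (2 κ)`, so the pair enters only through `κ_i` and `κ_j`; all indices share the
denominator `d` of `β`. With `δ = |u_i v_i - u_j v_j| / (U V)`, the derivative of `g_i(z/r) -
g_j(z/r)` is `O(δ η)`, and its second derivative has constant sign and is `≫ δ η / L`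
(`exists_phaseDeriv_bounds`). The size conditions on `L`, `U`, `V` bound `b κ / z` below, so that `s
- 1` and `s + 1` have the same order and both signs can be treated alike (`le_ratio`).

If `‖θ‖` dominates `δ η`, the Kuzmin–Landau inequality bounds the unweighted sum by `O(1/‖θ‖)`.
Otherwise the second derivative test applies. Either way the sum is `O(T)` for some `T ≤ L` such
that `T ≤ X₀`, or else both `‖θ‖ T² ≪ L` and `δ η T² ≪ L` (`exists_sum_bound_of_phase`). The last
two inequalities say that the pair is counted by `B(Δ₁(X), Δ₂(X))` for every positive `X ≤ T`, so
`T` is at most `X₀` plus the integral over `[X₀, L]` of the indicator of being counted. Summation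
over pairs gives the theorem, because `j ↦ (u_j, v_j)` is injective and there are at most `(#ℛ)²`
pairs. -/

/-! ### The additive character. -/

theorem e_add (x y : ℝ) : e (x + y) = e x * e y := by
  simp only [e, ← Complex.exp_add]; congr 1; push_cast; ring

theorem e_eq_exp_mul_I (x : ℝ) : e x = Complex.exp ((2 * Real.pi * x : ℝ) * Complex.I) := by
  simp only [e]; congr 1; push_cast; ring

theorem norm_e (x : ℝ) : ‖e x‖ = 1 := by
  rw [e_eq_exp_mul_I, Complex.norm_exp_ofReal_mul_I]

theorem conj_e (x : ℝ) : (starRingEnd ℂ) (e x) = e (-x) := by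
  rw [e_eq_exp_mul_I, e_eq_exp_mul_I, ← Complex.exp_conj]
  congr 1
  simp only [map_mul, Complex.conj_ofReal, Complex.conj_I]
  push_cast
  ring

theorem e_intCast (n : ℤ) : e n = 1 := by
  simp only [e]
  rw [← Complex.exp_int_mul_two_pi_mul_I n]; congr 1; push_cast; ring

theorem norm_sum_e_neg (s : Finset ℕ) (f : ℕ → ℝ) :
    ‖∑ n ∈ s, e (-f n)‖ = ‖∑ n ∈ s, e (f n)‖ := by
  rw [← Complex.norm_conj, map_sum]
  simp [conj_e]

theorem norm_sum_e_le_card (s : Finset ℕ) (f : ℕ → ℝ) : ‖∑ n ∈ s, e (f n)‖ ≤ s.card := by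
  refine (norm_sum_le _ _).trans ?_
  simp [norm_e]

/-! ### Removal of weights by partial summation. -/

/-- Multiplication by `w` enlarges bounds for partial sums over `[A, B)` by at most the factor `K`. -/
def IsMultiplier (A B : ℕ) (w : ℕ → ℝ) (K : ℝ) : Prop :=
  ∀ (a : ℕ → ℂ) (T : ℝ), (∀ b ≤ B, ‖∑ n ∈ Finset.Ico A b, a n‖ ≤ T) →
    ∀ b ≤ B, ‖∑ n ∈ Finset.Ico A b, (w n : ℂ) * a n‖ ≤ K * T

namespace IsMultiplier

variable {A B : ℕ} {w w₁ w₂ : ℕ → ℝ} {K K₁ K₂ W : ℝ}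

/-- Hypothesis and conclusion of `IsMultiplier` both concern all partial sums, so the output of one
multiplier can be fed into the next. A product of weights therefore never has to be monotone itself.
-/
theorem mul (h₁ : IsMultiplier A B w₁ K₁) (h₂ : IsMultiplier A B w₂ K₂) :
    IsMultiplier A B (fun n => w₁ n * w₂ n) (K₁ * K₂) := by
  intro a T ha b hb
  have := h₁ (fun n => (w₂ n : ℂ) * a n) (K₂ * T) (h₂ a T ha) b hb
  simpa [mul_assoc] using this

theorem add (h₁ : IsMultiplier A B w₁ K₁) (h₂ : IsMultiplier A B w₂ K₂) :
    IsMultiplier A B (fun n => w₁ n + w₂ n) (K₁ + K₂) := by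
  intro a T ha b hb
  simp only [Complex.ofReal_add, add_mul, Finset.sum_add_distrib]
  exact (norm_add_le _ _).trans (add_le_add (h₁ a T ha b hb) (h₂ a T ha b hb))

theorem const (k : ℝ) : IsMultiplier A B (fun _ => k) |k| := by
  intro a T ha b hb
  rw [← Finset.mul_sum, norm_mul, Complex.norm_real, Real.norm_eq_abs]
  exact mul_le_mul_of_nonneg_left (ha b hb) (abs_nonneg _)

theorem sub (h₁ : IsMultiplier A B w₁ K₁) (h₂ : IsMultiplier A B w₂ K₂) :
    IsMultiplier A B (fun n => w₁ n - w₂ n) (K₁ + K₂) := by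
  have := h₁.add ((const (-1)).mul h₂)
  simpa [sub_eq_add_neg] using this

theorem mono (h : IsMultiplier A B w K₁) (hK : K₁ ≤ K₂) : IsMultiplier A B w K₂ := by
  intro a T ha b hb
  have hT : 0 ≤ T := (norm_nonneg _).trans (ha b hb)
  exact (h a T ha b hb).trans (mul_le_mul_of_nonneg_right hK hT)

theorem congr (h : IsMultiplier A B w₁ K) (hw : ∀ n, A ≤ n → n < B → w₂ n = w₁ n) :
    IsMultiplier A B w₂ K := by
  intro a T ha b hb
  have : ∑ n ∈ Finset.Ico A b, (w₂ n : ℂ) * a n = ∑ n ∈ Finset.Ico A b, (w₁ n : ℂ) * a n := by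
    refine Finset.sum_congr rfl fun n hn => ?_
    rw [Finset.mem_Ico] at hn
    rw [hw n hn.1 (hn.2.trans_le hb)]
  rw [this]; exact h a T ha b hb

theorem sum_by_parts (w : ℕ → ℝ) (a : ℕ → ℂ) {b : ℕ} (hb : A ≤ b) :
    ∑ n ∈ Finset.Ico A (b + 1), (w n : ℂ) * a n
      = w b * ∑ n ∈ Finset.Ico A (b + 1), a n
        + ∑ n ∈ Finset.Ico A b, ((w n - w (n + 1) : ℝ) : ℂ) * ∑ k ∈ Finset.Ico A (n + 1), a k := by
  induction b, hb using Nat.le_induction with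
  | base => simp
  | succ b hb ih =>
    rw [Finset.sum_Ico_succ_top (by omega), ih,
      Finset.sum_Ico_succ_top (by omega : A ≤ b + 1) a,
      Finset.sum_Ico_succ_top (by omega : A ≤ b)
        (fun n => ((w n - w (n + 1) : ℝ) : ℂ) * ∑ k ∈ Finset.Ico A (n + 1), a k)]
    push_cast
    ring

/-- Abel summation: the boundary term contributes `W`, and the total variation of a monotone weight
is at most `2 W`. -/
theorem of_antitoneOn (hw : AntitoneOn w (Set.Ico A B)) (hW₀ : 0 ≤ W)
    (hW : ∀ n, A ≤ n → n < B → |w n| ≤ W) :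
    IsMultiplier A B w (3 * W) := by
  intro a T ha b hb
  have hT : 0 ≤ T := (norm_nonneg _).trans (ha b hb)
  rcases le_or_gt b A with h | h
  · rw [Finset.Ico_eq_empty (by omega), Finset.sum_empty, norm_zero]
    positivity
  obtain ⟨b, rfl⟩ : ∃ k, b = k + 1 := ⟨b - 1, by omega⟩
  have hAb : A ≤ b := by omega
  rw [sum_by_parts w a hAb]
  have h1 : ‖(w b : ℂ) * ∑ n ∈ Finset.Ico A (b + 1), a n‖ ≤ W * T := by
    rw [norm_mul, Complex.norm_real, Real.norm_eq_abs]
    exact mul_le_mul (hW b hAb (by omega)) (ha _ hb) (norm_nonneg _)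
      ((abs_nonneg _).trans (hW b hAb (by omega)))
  have h2 : ‖∑ n ∈ Finset.Ico A b, ((w n - w (n + 1) : ℝ) : ℂ) * ∑ k ∈ Finset.Ico A (n + 1), a k‖
      ≤ (w A - w b) * T := by
    refine (norm_sum_le _ _).trans ?_
    have : ∀ n ∈ Finset.Ico A b,
        ‖((w n - w (n + 1) : ℝ) : ℂ) * ∑ k ∈ Finset.Ico A (n + 1), a k‖
          ≤ (w n - w (n + 1)) * T := by
      intro n hn
      rw [Finset.mem_Ico] at hn
      have hd : 0 ≤ w n - w (n + 1) :=
        sub_nonneg.2 (hw ⟨hn.1, by omega⟩ ⟨by omega, by omega⟩ (Nat.le_succ n))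
      rw [norm_mul, Complex.norm_real, Real.norm_eq_abs, abs_of_nonneg hd]
      exact mul_le_mul_of_nonneg_left (ha _ (by omega)) hd
    refine (Finset.sum_le_sum this).trans ?_
    have := Finset.sum_Ico_sub w hAb
    rw [← Finset.sum_mul]
    refine le_of_eq ?_
    congr 1
    rw [← neg_sub (w b), ← this, ← Finset.sum_neg_distrib]
    simp
  have h3 := abs_le.1 (hW A le_rfl (by omega))
  have h4 := abs_le.1 (hW b hAb (by omega))
  refine (norm_add_le _ _).trans ?_
  have : (w A - w b) * T ≤ 2 * W * T := mul_le_mul_of_nonneg_right (by linarith) hT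
  linarith

theorem of_monotoneOn (hw : MonotoneOn w (Set.Ico A B)) (hW₀ : 0 ≤ W)
    (hW : ∀ n, A ≤ n → n < B → |w n| ≤ W) : IsMultiplier A B w (3 * W) := by
  have h := (const (A := A) (B := B) (-1)).mul
    (of_antitoneOn (w := fun n => -w n) hw.neg hW₀ (by simpa using hW))
  simpa using h

end IsMultiplier

/-! ### The Kuzmin–Landau inequality. -/

/-- This is `1 / (1 - e x) = (1 + i cot πx) / 2` without division. It writes a term `e (f n)` as a
multiple of a telescoping difference, with a factor that is monotone in the first difference of `f`.
-/
theorem e_sub_mul_cot {x : ℝ} (hx : Real.sin (Real.pi * x) ≠ 0) :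
    (1 - e x) * (1 + (Real.cos (Real.pi * x) / Real.sin (Real.pi * x) : ℝ) * Complex.I) = 2 := by
  have h1 : e x = (Real.cos (Real.pi * x) + Real.sin (Real.pi * x) * Complex.I) ^ 2 := by
    rw [e_eq_exp_mul_I, Complex.ofReal_cos, Complex.ofReal_sin, ← Complex.exp_mul_I,
      ← Complex.exp_nat_mul]
    congr 1; push_cast; ring
  have hs : (Real.sin (Real.pi * x) : ℂ) ≠ 0 := by exact_mod_cast hx
  have h2 : (Real.sin (Real.pi * x) : ℂ) ^ 2 + (Real.cos (Real.pi * x) : ℂ) ^ 2 = 1 := by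
    exact_mod_cast Real.sin_sq_add_cos_sq (Real.pi * x)
  rw [h1, Complex.ofReal_div]
  field_simp
  generalize (Real.sin (Real.pi * x) : ℂ) = S at *
  generalize (Real.cos (Real.pi * x) : ℂ) = C at *
  have hI := Complex.I_sq
  have hC : C ^ 2 = 1 - S ^ 2 := by linear_combination h2
  ring_nf
  simp only [show Complex.I ^ 3 = -Complex.I by rw [pow_succ, hI]; ring, hI]
  have hC3 : C ^ 3 = C * (1 - S ^ 2) := by rw [← hC]; ring
  rw [hC3, hC]
  ring

theorem two_mul_le_sin_pi_mul {μ x : ℝ} (hμ : 0 ≤ μ) (h1 : μ ≤ x) (h2 : x ≤ 1 - μ) :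
    2 * μ ≤ Real.sin (Real.pi * x) := by
  have hpi := Real.pi_pos
  rcases le_total x (1 / 2) with h | h
  · have := Real.mul_le_sin (x := Real.pi * x) (mul_nonneg hpi.le (hμ.trans h1)) (by nlinarith)
    have h3 : 2 / Real.pi * (Real.pi * x) = 2 * x := by field_simp
    linarith
  · have := Real.mul_le_sin (x := Real.pi * (1 - x)) (by nlinarith) (by nlinarith)
    have h3 : 2 / Real.pi * (Real.pi * (1 - x)) = 2 * (1 - x) := by field_simp
    have h4 : Real.sin (Real.pi * (1 - x)) = Real.sin (Real.pi * x) := by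
      rw [mul_sub, mul_one, Real.sin_pi_sub]
    linarith

/-- The differences `e (f n) - e (f (n + 1))` have partial sums bounded by `2`, and the cotangent of
`π` times the first difference is decreasing and at most `1 / (2μ)` in absolute value. Partial
summation then gives `1 + 3 / (2μ)`, which is at most `2 / μ` because `μ ≤ 1/2`. -/
theorem kuzmin_landau_zero {f : ℕ → ℝ} {A B : ℕ} {μ : ℝ} (hμ : 0 < μ)
    (hmono : MonotoneOn (fun n => f (n + 1) - f n) (Set.Ico A B))
    (hD : ∀ n, A ≤ n → n < B → μ ≤ f (n + 1) - f n ∧ f (n + 1) - f n ≤ 1 - μ) :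
    ‖∑ n ∈ Finset.Ico A B, e (f n)‖ ≤ 2 / μ := by
  rcases le_or_gt B A with hBA | hAB
  · rw [Finset.Ico_eq_empty (by omega)]
    simp; positivity
  have hμ2 : μ ≤ 1 / 2 := by linarith [hD A le_rfl hAB]
  set w : ℕ → ℝ := fun n =>
    Real.cos (Real.pi * (f (n + 1) - f n)) / Real.sin (Real.pi * (f (n + 1) - f n)) with hw
  have hsin : ∀ n, A ≤ n → n < B → 2 * μ ≤ Real.sin (Real.pi * (f (n + 1) - f n)) := fun n h1 h2 =>
    two_mul_le_sin_pi_mul hμ.le (hD n h1 h2).1 (hD n h1 h2).2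
  have hwb : ∀ n, A ≤ n → n < B → |w n| ≤ 1 / (2 * μ) := by
    intro n h1 h2
    have h3 := hsin n h1 h2
    rw [hw, abs_div, abs_of_pos (by linarith : 0 < Real.sin (Real.pi * (f (n + 1) - f n)))]
    exact div_le_div₀ zero_le_one (Real.abs_cos_le_one _) (by positivity) h3
  have hanti : AntitoneOn w (Set.Ico A B) := by
    intro m hm n hn hmn
    have h1 := hsin m hm.1 hm.2
    have h2 := hsin n hn.1 hn.2
    have h3 := hmono hm hn hmn
    simp only at h3
    have h4 := (hD m hm.1 hm.2).1
    have h5 := (hD n hn.1 hn.2).2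
    simp only [hw]
    rw [div_le_div_iff₀ (by linarith) (by linarith)]
    -- The cotangent decreases because `cot x - cot y = sin (y - x) / (sin x sin y)`.
    have h6 : 0 ≤ Real.sin (Real.pi * (f (n + 1) - f n) - Real.pi * (f (m + 1) - f m)) := by
      rw [← mul_sub]
      have hpi := Real.pi_pos
      exact Real.sin_nonneg_of_nonneg_of_le_pi (mul_nonneg hpi.le (by linarith)) (by nlinarith)
    rw [Real.sin_sub] at h6
    linarith
  have key : ∀ n ∈ Finset.Ico A B, e (f n) = 1 / 2 * (e (f n) - e (f (n + 1)))
      + Complex.I / 2 * ((w n : ℂ) * (e (f n) - e (f (n + 1)))) := by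
    intro n hn
    rw [Finset.mem_Ico] at hn
    have h1 := e_sub_mul_cot (x := f (n + 1) - f n) (by linarith [hsin n hn.1 hn.2])
    have h2 : e (f (n + 1)) = e (f n) * e (f (n + 1) - f n) := by rw [← e_add]; congr 1; ring
    rw [h2]
    simp only [hw]
    linear_combination (-(1 / 2) * e (f n)) * h1
  have htel : ∀ b, ‖∑ n ∈ Finset.Ico A b, (e (f n) - e (f (n + 1)))‖ ≤ 2 := by
    intro b
    rcases le_or_gt b A with h | h
    · rw [Finset.Ico_eq_empty (by omega)]; simp
    · have := Finset.sum_Ico_sub (fun n => e (f n)) h.le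
      rw [← norm_neg, ← Finset.sum_neg_distrib]
      simp only [neg_sub]
      rw [this]
      refine (norm_sub_le _ _).trans ?_
      rw [norm_e, norm_e]; norm_num
  have hm := IsMultiplier.of_antitoneOn hanti (by positivity) hwb _ 2 (fun b _ => htel b) B le_rfl
  rw [Finset.sum_congr rfl key, Finset.sum_add_distrib, ← Finset.mul_sum, ← Finset.mul_sum]
  refine (norm_add_le _ _).trans ?_
  rw [norm_mul, norm_mul]
  have n1 : ‖(1 / 2 : ℂ)‖ = 1 / 2 := by norm_num
  have n2 : ‖(Complex.I / 2 : ℂ)‖ = 1 / 2 := by simp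
  rw [n1, n2]
  have h7 : (2 : ℝ) / μ = 4 * (1 / (2 * μ)) := by field_simp; norm_num
  have h8 : 1 ≤ 1 / (2 * μ) := by rw [le_div_iff₀ (by positivity)]; linarith
  have h9 := htel B
  rw [h7]
  linarith

/-- The Kuzmin–Landau inequality. -/
theorem kuzmin_landau {f : ℕ → ℝ} {A B : ℕ} {μ : ℝ} (m : ℤ) (hμ : 0 < μ)
    (hmono : MonotoneOn (fun n => f (n + 1) - f n) (Set.Ico A B))
    (hD : ∀ n, A ≤ n → n < B → m + μ ≤ f (n + 1) - f n ∧ f (n + 1) - f n ≤ m + 1 - μ) :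
    ‖∑ n ∈ Finset.Ico A B, e (f n)‖ ≤ 2 / μ := by
  -- Subtracting `m n`, an integer, changes no term and moves the first differences into `[μ, 1 -
  -- μ]`.
  have h := kuzmin_landau_zero (f := fun n => f n - m * n) (A := A) (B := B) hμ ?_ ?_
  · convert h using 3 with n hn
    have : e (f n - m * n) = e (f n) * e ((-(m * n) : ℤ) : ℝ) := by
      rw [← e_add]; congr 1; push_cast; ring
    rw [this, e_intCast, mul_one]
  · intro i hi j hj hij
    have := hmono hi hj hij
    simp only at this ⊢
    push_cast
    linarith
  · intro n h1 h2
    have := hD n h1 h2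
    push_cast
    constructor <;> linarith

/-! ### The second derivative test for sequences. -/

theorem card_le_of_separated {A B : ℕ} {D : ℕ → ℝ} {lam x ℓ : ℝ} (hlam : 0 < lam) (hℓ : 0 ≤ ℓ)
    (hD : ∀ i j, A ≤ i → i ≤ j → j < B → lam * ((j : ℝ) - i) ≤ D j - D i) (s : Finset ℕ)
    (hs : ∀ n ∈ s, A ≤ n ∧ n < B ∧ x ≤ D n ∧ D n ≤ x + ℓ) : (s.card : ℝ) ≤ ℓ / lam + 1 := by
  rcases s.eq_empty_or_nonempty with rfl | hne
  · simp; positivity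
  have h1 := hs _ (s.min'_mem hne)
  have h2 := hs _ (s.max'_mem hne)
  have hle : s.min' hne ≤ s.max' hne := s.min'_le_max' hne
  have h3 := hD _ _ h1.1 hle h2.2.1
  have hsub : s ⊆ Finset.Icc (s.min' hne) (s.max' hne) := fun n hn =>
    Finset.mem_Icc.2 ⟨s.min'_le n hn, s.le_max' n hn⟩
  have h4 := Finset.card_le_card hsub
  rw [Nat.card_Icc] at h4
  have h5 : (s.card : ℝ) ≤ (s.max' hne : ℝ) - s.min' hne + 1 := by
    have : s.card + s.min' hne ≤ s.max' hne + 1 := by omega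
    have : (s.card : ℝ) + s.min' hne ≤ s.max' hne + 1 := by exact_mod_cast this
    linarith
  have h6 : (s.max' hne : ℝ) - s.min' hne ≤ ℓ / lam := by
    rw [le_div_iff₀ hlam]; linarith
  linarith

/-- A sum of `e (f n)` over those `n` for which `f (n + 1) - f n` has integer part `m`. -/
theorem norm_sum_floor_eq_le {f : ℕ → ℝ} {A B : ℕ} {lam : ℝ} (hlam : 0 < lam) (m : ℤ)
    (hD : ∀ i j, A ≤ i → i ≤ j → j < B →
      lam * ((j : ℝ) - i) ≤ (f (j + 1) - f j) - (f (i + 1) - f i)) :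
    ‖∑ n ∈ Finset.Ico A B with ⌊f (n + 1) - f n⌋ = m, e (f n)‖ ≤ 4 / √lam + 2 := by
  set D : ℕ → ℝ := fun n => f (n + 1) - f n with hDdef
  have hmono : MonotoneOn D (Set.Ico A B) := by
    intro i hi j hj hij
    have h1 := hD i j hi.1 hij hj.2
    have h2 : (0 : ℝ) ≤ (j : ℝ) - i := sub_nonneg.2 (by exact_mod_cast hij)
    have := mul_nonneg hlam.le h2
    simp only [hDdef]; linarith
  have hsq : 0 < √lam := Real.sqrt_pos.2 hlam
  have hq : √lam / lam = 1 / √lam := by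
    rw [div_eq_div_iff hlam.ne' hsq.ne', Real.mul_self_sqrt hlam.le, one_mul]
  -- The threshold balances the Kuzmin–Landau bound `2 / μ` for differences at distance at least `μ`
  -- from the integers against the number `μ / lam + 1` of terms near each end, estimated trivially.
  set μ := √lam
  set F := {n ∈ Finset.Ico A B | ⌊D n⌋ = m} with hF
  set G := {n ∈ F | m + μ ≤ D n ∧ D n ≤ m + 1 - μ} with hG
  set B₁ := {n ∈ F | D n < m + μ} with hB₁
  set B₂ := {n ∈ F | m + 1 - μ < D n} with hB₂
  have hFm : ∀ n ∈ F, A ≤ n ∧ n < B ∧ (m : ℝ) ≤ D n ∧ D n < m + 1 := by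
    intro n hn
    rw [hF, Finset.mem_filter, Finset.mem_Ico, Int.floor_eq_iff] at hn
    exact ⟨hn.1.1, hn.1.2, hn.2.1, hn.2.2⟩
  have c1 : (B₁.card : ℝ) ≤ μ / lam + 1 := by
    refine card_le_of_separated (x := m) hlam hsq.le hD B₁ fun n hn => ?_
    rw [hB₁, Finset.mem_filter] at hn
    have := hFm n hn.1
    exact ⟨this.1, this.2.1, this.2.2.1, hn.2.le⟩
  have c2 : (B₂.card : ℝ) ≤ μ / lam + 1 := by
    refine card_le_of_separated (x := m + 1 - μ) hlam hsq.le hD B₂ fun n hn => ?_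
    rw [hB₂, Finset.mem_filter] at hn
    have := hFm n hn.1
    exact ⟨this.1, this.2.1, hn.2.le, by linarith⟩
  have cG : ‖∑ n ∈ G, e (f n)‖ ≤ 2 / μ := by
    rcases G.eq_empty_or_nonempty with h | hne
    · rw [h]; simp; positivity
    have hGm : ∀ n ∈ G, A ≤ n ∧ n < B ∧ m + μ ≤ D n ∧ D n ≤ m + 1 - μ := by
      intro n hn
      rw [hG, Finset.mem_filter] at hn
      exact ⟨(hFm n hn.1).1, (hFm n hn.1).2.1, hn.2⟩
    have hmin := hGm _ (G.min'_mem hne)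
    have hmax := hGm _ (G.max'_mem hne)
    have hbd : ∀ n, G.min' hne ≤ n → n < G.max' hne + 1 → A ≤ n ∧ n < B ∧
        m + μ ≤ D n ∧ D n ≤ m + 1 - μ := by
      intro n h1 h2
      have hA : A ≤ n := hmin.1.trans h1
      have hB : n < B := by omega
      refine ⟨hA, hB, hmin.2.2.1.trans (hmono ⟨hmin.1, hmin.2.1⟩ ⟨hA, hB⟩ h1),
        (hmono ⟨hA, hB⟩ ⟨hmax.1, hmax.2.1⟩ (by omega)).trans hmax.2.2.2⟩
    -- By monotonicity of `D` the middle range is a block of consecutive integers, as Kuzmin–Landau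
    -- requires.
    have hGI : G = Finset.Ico (G.min' hne) (G.max' hne + 1) := by
      ext n
      rw [Finset.mem_Ico]
      constructor
      · intro hn
        exact ⟨G.min'_le n hn, Nat.lt_succ_of_le (G.le_max' n hn)⟩
      · rintro ⟨h1, h2⟩
        obtain ⟨hA, hB, h3, h4⟩ := hbd n h1 h2
        rw [hG, Finset.mem_filter, hF, Finset.mem_filter, Finset.mem_Ico, Int.floor_eq_iff]
        exact ⟨⟨⟨hA, hB⟩, by linarith, by linarith⟩, h3, h4⟩
    rw [hGI]
    refine kuzmin_landau m hsq (hmono.mono fun n hn => ?_) fun n h1 h2 => (hbd n h1 h2).2.2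
    obtain ⟨hA, hB, -⟩ := hbd n hn.1 hn.2
    exact ⟨hA, hB⟩
  have hsplit : ∑ n ∈ F, e (f n) = ∑ n ∈ G, e (f n)
      + ∑ n ∈ F with ¬ (m + μ ≤ D n ∧ D n ≤ m + 1 - μ), e (f n) :=
    (Finset.sum_filter_add_sum_filter_not F _ _).symm
  rw [hsplit]
  have hsub : {n ∈ F | ¬ (m + μ ≤ D n ∧ D n ≤ m + 1 - μ)} ⊆ B₁ ∪ B₂ := by
    intro n hn
    rw [Finset.mem_filter] at hn
    rw [Finset.mem_union]
    by_cases h : D n < m + μ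
    · exact Or.inl (Finset.mem_filter.2 ⟨hn.1, h⟩)
    · refine Or.inr (Finset.mem_filter.2 ⟨hn.1, ?_⟩)
      by_contra h'
      exact hn.2 ⟨not_lt.1 h, not_lt.1 h'⟩
  have hcard : (({n ∈ F | ¬ (m + μ ≤ D n ∧ D n ≤ m + 1 - μ)}.card : ℕ) : ℝ) ≤ B₁.card + B₂.card := by
    exact_mod_cast (Finset.card_le_card hsub).trans (Finset.card_union_le _ _)
  have := norm_sum_e_le_card {n ∈ F | ¬ (m + μ ≤ D n ∧ D n ≤ m + 1 - μ)} f
  refine (norm_add_le _ _).trans ?_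
  have e4 : 4 / μ = 2 / μ + 2 * (1 / μ) := by ring
  rw [hq] at c1 c2
  linarith

/-- The second derivative test, for sequences with increasing first differences. -/
theorem norm_sum_e_le_of_separated {f : ℕ → ℝ} {A B : ℕ} {lam K : ℝ} (hlam : 0 < lam) (hK : 0 ≤ K)
    (hD : ∀ i j, A ≤ i → i ≤ j → j < B →
      lam * ((j : ℝ) - i) ≤ (f (j + 1) - f j) - (f (i + 1) - f i))
    (hrange : ∀ i j, A ≤ i → i ≤ j → j < B → (f (j + 1) - f j) - (f (i + 1) - f i) ≤ K) :
    ‖∑ n ∈ Finset.Ico A B, e (f n)‖ ≤ (K + 2) * (4 / √lam + 2) := by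
  have hpos : 0 ≤ 4 / √lam + 2 := by positivity
  rcases le_or_gt B A with hBA | hAB
  · rw [Finset.Ico_eq_empty (by omega)]
    simp only [Finset.sum_empty, norm_zero]; positivity
  set D : ℕ → ℝ := fun n => f (n + 1) - f n with hDdef
  obtain ⟨b, rfl⟩ : ∃ k, B = k + 1 := ⟨B - 1, by omega⟩
  have hmono : ∀ i j, A ≤ i → i ≤ j → j < b + 1 → D i ≤ D j := by
    intro i j hi hij hj
    have h1 := hD i j hi hij hj
    have h2 : (0 : ℝ) ≤ (j : ℝ) - i := sub_nonneg.2 (by exact_mod_cast hij)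
    have := mul_nonneg hlam.le h2
    simp only [hDdef]; linarith
  have hmaps : ∀ n ∈ Finset.Ico A (b + 1), ⌊D n⌋ ∈ Finset.Icc ⌊D A⌋ ⌊D b⌋ := by
    intro n hn
    rw [Finset.mem_Ico] at hn
    rw [Finset.mem_Icc]
    exact ⟨Int.floor_mono (hmono A n le_rfl hn.1 hn.2),
      Int.floor_mono (hmono n b hn.1 (by omega) (by omega))⟩
  -- Split by the integer part of the first difference. The differences vary by at most `K`, so at
  -- most `K + 2` integer parts occur.
  rw [← Finset.sum_fiberwise_of_maps_to hmaps]
  refine (norm_sum_le _ _).trans ?_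
  refine (Finset.sum_le_card_nsmul _ _ _ fun m _ => norm_sum_floor_eq_le hlam m hD).trans ?_
  rw [nsmul_eq_mul]
  refine mul_le_mul_of_nonneg_right ?_ hpos
  have h1 := hrange A b le_rfl (by omega) (by omega)
  have h2 := Int.floor_le (D b)
  have h3 := Int.lt_floor_add_one (D A)
  have h4 := Int.floor_mono (hmono A b le_rfl (by omega) (by omega))
  have h5 : ((Finset.Icc ⌊D A⌋ ⌊D b⌋).card : ℤ) = ⌊D b⌋ + 1 - ⌊D A⌋ := by
    rw [Int.card_Icc]; omega
  have h6 : ((Finset.Icc ⌊D A⌋ ⌊D b⌋).card : ℝ) = ⌊D b⌋ + 1 - ⌊D A⌋ := by exact_mod_cast h5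
  rw [h6]
  simp only [hDdef] at h2 h3 ⊢
  linarith

/-! ### Derivative tests for differentiable phases. -/

section Phase

variable {φ φ' : ℝ → ℝ} {A B : ℕ} {θ ρ lam : ℝ}

/-- The second difference is the increment over `[i, i + 1]` of `z ↦ φ (z + (j - i)) - φ z`, whose
derivative is at least `lam * (j - i)`. Only growth of `φ'` is needed, not a second derivative. -/
theorem separated_of_hasDerivAt (hφ : ∀ z ∈ Set.Icc (A : ℝ) B, HasDerivAt φ (φ' z) z)
    (hsep : ∀ x ∈ Set.Icc (A : ℝ) B, ∀ y ∈ Set.Icc (A : ℝ) B, x ≤ y →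
      lam * (y - x) ≤ φ' y - φ' x) (i j : ℕ) (hi : A ≤ i) (hij : i ≤ j) (hj : j < B) :
    lam * ((j : ℝ) - i) ≤ (φ ((j + 1 : ℕ) : ℝ) - φ j) - (φ ((i + 1 : ℕ) : ℝ) - φ i) := by
  have hAi : (A : ℝ) ≤ i := by exact_mod_cast hi
  have hij' : (i : ℝ) ≤ j := by exact_mod_cast hij
  have hjB : (j : ℝ) + 1 ≤ B := by exact_mod_cast hj
  have hd : ∀ z ∈ Set.Icc (i : ℝ) (i + 1),
      HasDerivAt (fun z => φ (z + ((j : ℝ) - i)) - φ z) (φ' (z + ((j : ℝ) - i)) - φ' z) z := by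
    intro z hz
    refine HasDerivAt.sub ?_ (hφ z ⟨by linarith [hz.1], by linarith [hz.2]⟩)
    exact (hφ (z + ((j : ℝ) - i)) ⟨by linarith [hz.1], by linarith [hz.2]⟩).comp_add_const z _
  have h := (convex_Icc (i : ℝ) (i + 1)).mul_sub_le_image_sub_of_le_deriv
    (C := lam * ((j : ℝ) - i)) (fun z hz => (hd z hz).continuousAt.continuousWithinAt)
    (fun z hz => (hd z (interior_subset hz)).differentiableAt.differentiableWithinAt)
    (fun z hz => ?_) i ⟨le_rfl, by linarith⟩ (i + 1) ⟨by linarith, le_rfl⟩ (by linarith)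
  · have e1 : (i : ℝ) + 1 + (j - i) = j + 1 := by ring
    have e2 : (i : ℝ) + (j - i) = j := by ring
    rw [e1, e2] at h
    push_cast
    linarith
  · have hz' := interior_subset hz
    rw [(hd z hz').deriv]
    have := hsep z ⟨by linarith [hz'.1], by linarith [hz'.2]⟩ (z + ((j : ℝ) - i))
      ⟨by linarith [hz'.1], by linarith [hz'.2]⟩ (by linarith)
    simpa using this

theorem abs_diff_sub_le (hφ : ∀ z ∈ Set.Icc (A : ℝ) B, HasDerivAt φ (φ' z) z)
    (hρ : ∀ z ∈ Set.Icc (A : ℝ) B, |φ' z - θ| ≤ ρ) (n : ℕ) (h1 : A ≤ n) (h2 : n < B) :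
    |φ ((n + 1 : ℕ) : ℝ) - φ n - θ| ≤ ρ := by
  have hAn : (A : ℝ) ≤ n := by exact_mod_cast h1
  have hnB : (n : ℝ) + 1 ≤ B := by exact_mod_cast h2
  obtain ⟨z, hz, hz'⟩ := exists_hasDerivAt_eq_slope φ φ' (by linarith : (n : ℝ) < n + 1)
    (fun z hz => (hφ z ⟨by linarith [hz.1], by linarith [hz.2]⟩).continuousAt.continuousWithinAt)
    (fun z hz => hφ z ⟨by linarith [hz.1], by linarith [hz.2]⟩)
  have := hρ z ⟨by linarith [hz.1], by linarith [hz.2]⟩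
  rw [hz'] at this
  simpa using this

theorem distInt_neg (x : ℝ) : distInt (-x) = distInt x := by
  have key : ∀ y : ℝ, distInt (-y) ≤ distInt y := by
    intro y
    have h := round_le (-y) (-round y)
    simp only [distInt]
    refine h.trans_eq ?_
    push_cast
    rw [← abs_neg]
    congr 1
    ring
  refine le_antisymm (key x) ?_
  simpa using key (-x)

/-- The first derivative test for a phase with derivative close to `θ`. -/
theorem norm_sum_e_le_of_distInt (hφ : ∀ z ∈ Set.Icc (A : ℝ) B, HasDerivAt φ (φ' z) z)
    (hmono : MonotoneOn φ' (Set.Icc (A : ℝ) B))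
    (hρ : ∀ z ∈ Set.Icc (A : ℝ) B, |φ' z - θ| ≤ ρ) (hθ : 0 < distInt θ)
    (hρθ : 2 * ρ ≤ distInt θ) :
    ‖∑ n ∈ Finset.Ico A B, e (φ n)‖ ≤ 4 / distInt θ := by
  -- All first differences lie within `ρ ≤ ‖θ‖ / 2` of `θ`, hence at distance at least `‖θ‖ / 2`
  -- from every integer.
  have h := kuzmin_landau (f := fun n => φ n) (A := A) (B := B) (μ := distInt θ / 2) ⌊θ⌋
    (by positivity) ?_ ?_
  · refine h.trans_eq ?_
    field_simp
    norm_num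
  · intro i hi j hj hij
    have := separated_of_hasDerivAt (lam := 0) hφ
      (fun x hx y hy hxy => by simpa using hmono hx hy hxy) i j hi.1 hij hj.2
    simp only at this ⊢
    linarith
  · intro n h1 h2
    have h3 := abs_le.1 (abs_diff_sub_le hφ hρ n h1 h2)
    have h4 : distInt θ = min (Int.fract θ) (1 - Int.fract θ) := abs_sub_round_eq_min θ
    have h5 : distInt θ ≤ Int.fract θ := h4.trans_le (min_le_left _ _)
    have h6 : distInt θ ≤ 1 - Int.fract θ := h4.trans_le (min_le_right _ _)
    have h7 := Int.floor_add_fract θ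
    constructor <;> linarith [h3.1, h3.2]

/-- The second derivative test for a phase with derivative close to `θ`. -/
theorem norm_sum_e_le_of_second_deriv (hφ : ∀ z ∈ Set.Icc (A : ℝ) B, HasDerivAt φ (φ' z) z)
    (hlam : 0 < lam)
    (hsep : ∀ x ∈ Set.Icc (A : ℝ) B, ∀ y ∈ Set.Icc (A : ℝ) B, x ≤ y →
      lam * (y - x) ≤ φ' y - φ' x)
    (hρ : ∀ z ∈ Set.Icc (A : ℝ) B, |φ' z - θ| ≤ ρ) (hρ₀ : 0 ≤ ρ) :
    ‖∑ n ∈ Finset.Ico A B, e (φ n)‖ ≤ (2 * ρ + 2) * (4 / √lam + 2) := by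
  refine norm_sum_e_le_of_separated (f := fun n => φ n) hlam (by positivity)
    (separated_of_hasDerivAt hφ hsep) ?_
  intro i j hi hij hj
  have h1 := abs_le.1 (abs_diff_sub_le hφ hρ i hi (by omega))
  have h2 := abs_le.1 (abs_diff_sub_le hφ hρ j (by omega) hj)
  linarith [h1.1, h2.2]

/-- The combination of the two tests that is used below, with `τ = η` up to a constant. -/
theorem exists_sum_bound_of_phase_pos {k L τ δ : ℝ} (hk : 1 ≤ k) (hL : 1 ≤ L) (hτ : 0 < τ)
    (hδ₀ : 0 ≤ δ) (hδ : δ ≤ 1)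
    (hφ : ∀ z ∈ Set.Icc (A : ℝ) B, HasDerivAt φ (φ' z) z)
    (hsep : ∀ x ∈ Set.Icc (A : ℝ) B, ∀ y ∈ Set.Icc (A : ℝ) B, x ≤ y →
      δ * τ / (k * L) * (y - x) ≤ φ' y - φ' x)
    (hρ : ∀ z ∈ Set.Icc (A : ℝ) B, |φ' z - θ| ≤ k * (δ * τ))
    (hcard : (B : ℝ) - A ≤ L) :
    ∃ T, 0 ≤ T ∧ T ≤ L ∧ (T ≤ √(L * max τ 1) ∨
        (distInt θ * T ^ 2 ≤ 2 * k * L ∧ δ * τ * T ^ 2 ≤ L)) ∧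
      ∀ b ≤ B, ‖∑ n ∈ Finset.Ico A b, e (φ n)‖ ≤ 40 * k ^ 2 * T := by
  have hk2 : 1 ≤ k ^ 2 := one_le_pow₀ hk
  have hρ₀ : 0 ≤ δ * τ := by positivity
  have htriv : ∀ b ≤ B, ‖∑ n ∈ Finset.Ico A b, e (φ n)‖ ≤ L := by
    intro b hb
    refine (norm_sum_e_le_card _ _).trans ?_
    rw [Nat.card_Ico]
    rcases le_total b A with h | h
    · rw [Nat.sub_eq_zero_of_le h]; push_cast; linarith
    · rw [Nat.cast_sub h]
      have : (b : ℝ) ≤ B := by exact_mod_cast hb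
      linarith
  have hsub : ∀ b : ℕ, b ≤ B → Set.Icc (A : ℝ) b ⊆ Set.Icc (A : ℝ) B := fun b hb =>
    Set.Icc_subset_Icc_right (by exact_mod_cast hb)
  have hmin : ∀ X : ℝ, 0 ≤ X → (∀ b ≤ B, ‖∑ n ∈ Finset.Ico A b, e (φ n)‖ ≤ 40 * k ^ 2 * X) →
      ∀ b ≤ B, ‖∑ n ∈ Finset.Ico A b, e (φ n)‖ ≤ 40 * k ^ 2 * min L X := by
    intro X hX h b hb
    rcases min_choice L X with h' | h' <;> rw [h']
    · exact (htriv b hb).trans (by nlinarith)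
    · exact h b hb
  have hdist : 0 ≤ distInt θ := abs_nonneg _
  rcases le_or_gt (2 * (k * (δ * τ))) (distInt θ) with hcase | hcase
  · rcases hdist.eq_or_lt with h0 | h0
    · have hz : δ * τ = 0 := by
        rw [← h0] at hcase
        nlinarith
      refine ⟨L, by linarith, le_rfl, Or.inr ⟨?_, ?_⟩, fun b hb => (htriv b hb).trans (by nlinarith)⟩
      · rw [← h0]; simp; positivity
      · rw [hz]; simp; positivity
    · have hT := hmin (1 / distInt θ) (by positivity) fun b hb => by
        have h := norm_sum_e_le_of_distInt (fun z hz => hφ z (hsub b hb hz))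
          (MonotoneOn.mono (fun x hx y hy hxy => ?_) (hsub b hb))
          (fun z hz => hρ z (hsub b hb hz)) h0 hcase
        · refine h.trans ?_
          rw [div_eq_mul_one_div]
          exact mul_le_mul_of_nonneg_right (by linarith) (by positivity)
        · have h1 := hsep x hx y hy hxy
          have h2 : 0 ≤ δ * τ / (k * L) * (y - x) :=
            mul_nonneg (by positivity) (sub_nonneg.2 hxy)
          linarith
      set T := min L (1 / distInt θ) with hTdef
      have hT0 : 0 ≤ T := le_min (by linarith) (by positivity)
      have hTL : T ≤ L := min_le_left _ _
      have hTθ : distInt θ * T ≤ 1 := by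
        have := min_le_right L (1 / distInt θ)
        rw [le_div_iff₀ h0] at this
        linarith
      have h1 : distInt θ * T ^ 2 ≤ L := by nlinarith
      refine ⟨T, hT0, hTL, Or.inr ⟨by nlinarith, ?_⟩, hT⟩
      have h2 : δ * τ ≤ distInt θ := by nlinarith
      nlinarith [sq_nonneg T]
  · have hpos : 0 < δ * τ := by
      by_contra hneg
      have : δ * τ = 0 := le_antisymm (not_lt.1 hneg) hρ₀
      rw [this] at hcase
      linarith
    have hδp : 0 < δ := hδ₀.lt_of_ne (by rintro rfl; simp at hpos)
    set Y := √(L * max τ 1) with hY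
    set Z := √(L / (δ * τ)) with hZ
    have hY1 : 1 ≤ Y := by
      rw [hY, Real.one_le_sqrt]
      nlinarith [le_max_right τ 1]
    have hLδ : √(L * (δ * τ)) ≤ Y := by
      refine Real.sqrt_le_sqrt (mul_le_mul_of_nonneg_left ?_ (by linarith))
      nlinarith [le_max_left τ 1]
    have hZ2 : Z ^ 2 * (δ * τ) = L := by
      rw [hZ, Real.sq_sqrt (by positivity)]
      field_simp
    have hZ0 : 0 ≤ Z := Real.sqrt_nonneg _
    have hbound : ∀ b ≤ B, ‖∑ n ∈ Finset.Ico A b, e (φ n)‖ ≤ 40 * k ^ 2 * max Y Z := by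
      intro b hb
      -- Up to constants the second derivative test gives `δ τ Z + δ τ + Z + 1`. Here `δ τ Z = √(L δ
      -- τ) ≤ Y`, and `δ τ ≤ √(L δ τ)` holds as long as `δ τ ≤ L`. Beyond that, the trivial bound
      -- `L` is already at most `√(L δ τ) ≤ Y`.
      rcases le_or_gt (δ * τ) L with hle | hgt
      · have h := norm_sum_e_le_of_second_deriv (A := A) (B := b) (lam := δ * τ / (k * L))
          (fun z hz => hφ z (hsub b hb hz))
          (by positivity) (fun x hx y hy hxy => hsep x (hsub b hb hx) y (hsub b hb hy) hxy)
          (fun z hz => hρ z (hsub b hb hz)) (by positivity)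
        refine h.trans ?_
        have e1 : 4 / √(δ * τ / (k * L)) ≤ 4 * k * Z := by
          rw [div_le_iff₀ (Real.sqrt_pos.2 (by positivity)), hZ, mul_assoc,
            ← Real.sqrt_mul (by positivity)]
          have : L / (δ * τ) * (δ * τ / (k * L)) = 1 / k := by field_simp
          rw [this]
          have : 1 / k ≤ √(1 / k) := by
            refine Real.le_sqrt_of_sq_le ?_
            have : 1 / k ≤ 1 := by rw [div_le_one (by linarith)]; exact hk
            have : 0 ≤ 1 / k := by positivity
            nlinarith
          have h3 : k * (1 / k) = 1 := by field_simp
          nlinarith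
        have e2 : δ * τ * Z = √(L * (δ * τ)) := by
          rw [hZ]
          rw [show δ * τ * √(L / (δ * τ)) = √((δ * τ) ^ 2) * √(L / (δ * τ)) by
            rw [Real.sqrt_sq hρ₀], ← Real.sqrt_mul (by positivity)]
          congr 1
          field_simp
        have e3 : δ * τ ≤ √(L * (δ * τ)) := Real.le_sqrt_of_sq_le (by nlinarith)
        have m1 := le_max_left Y Z
        have m2 := le_max_right Y Z
        set W := max Y Z
        calc (2 * (k * (δ * τ)) + 2) * (4 / √(δ * τ / (k * L)) + 2)
            ≤ (2 * (k * (δ * τ)) + 2) * (4 * k * Z + 2) := by gcongr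
          _ = 8 * k ^ 2 * (δ * τ * Z) + 4 * k * (δ * τ) + 8 * k * Z + 4 := by ring
          _ ≤ 8 * k ^ 2 * W + 4 * k ^ 2 * W + 8 * k ^ 2 * W + 4 * k ^ 2 * W := by
              have hk' : k ≤ k ^ 2 := by nlinarith
              have f1 : δ * τ * Z ≤ W := by rw [e2]; linarith
              have f2 : δ * τ ≤ W := by linarith
              have g1 : 8 * k ^ 2 * (δ * τ * Z) ≤ 8 * k ^ 2 * W := by gcongr
              have g2 : 4 * k * (δ * τ) ≤ 4 * k ^ 2 * W := by gcongr
              have g3 : 8 * k * Z ≤ 8 * k ^ 2 * W := by gcongr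
              have g4 : 4 ≤ 4 * k ^ 2 * W := by nlinarith
              linarith
          _ ≤ 40 * k ^ 2 * W := by nlinarith
      · have : L ≤ √(L * (δ * τ)) := Real.le_sqrt_of_sq_le (by nlinarith)
        have m1 := le_max_left Y Z
        have h0 := htriv b hb
        have : 40 * k ^ 2 * max Y Z ≥ 1 * max Y Z := by gcongr; nlinarith
        linarith
    -- If `Y` is the larger, `T ≤ Y` is the first alternative. If `Z` is, then `δ τ T² ≤ L`, and
    -- `‖θ‖ < 2 k δ τ` turns this into the bound for `‖θ‖ T²`.
    refine ⟨min L (max Y Z), le_min (by linarith) (le_max_of_le_right hZ0), min_le_left _ _, ?_,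
      hmin _ (le_max_of_le_right hZ0) hbound⟩
    rcases le_total Z Y with h | h
    · left; rw [max_eq_left h]; exact min_le_right _ _
    · right
      rw [max_eq_right h]
      have h0 : 0 ≤ min L Z := le_min (by linarith) hZ0
      have h1 : (min L Z) ^ 2 ≤ Z ^ 2 := pow_le_pow_left₀ h0 (min_le_right _ _) 2
      have h2 : δ * τ * (min L Z) ^ 2 ≤ L := by nlinarith
      refine ⟨?_, h2⟩
      have : distInt θ * (min L Z) ^ 2 ≤ 2 * (k * (δ * τ)) * (min L Z) ^ 2 := by gcongr
      nlinarith

/-- Complex conjugation replaces `φ` and `θ` by their negatives and preserves the modulus of the sum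
and `‖θ‖`, so decreasing derivatives are also covered. -/
theorem exists_sum_bound_of_phase {k L τ δ ε : ℝ} (hk : 1 ≤ k) (hL : 1 ≤ L) (hτ : 0 < τ)
    (hδ₀ : 0 ≤ δ) (hδ : δ ≤ 1) (hε : ε = 1 ∨ ε = -1)
    (hφ : ∀ z ∈ Set.Icc (A : ℝ) B, HasDerivAt φ (φ' z) z)
    (hsep : ∀ x ∈ Set.Icc (A : ℝ) B, ∀ y ∈ Set.Icc (A : ℝ) B, x ≤ y →
      δ * τ / (k * L) * (y - x) ≤ ε * (φ' y - φ' x))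
    (hρ : ∀ z ∈ Set.Icc (A : ℝ) B, |φ' z - θ| ≤ k * (δ * τ))
    (hcard : (B : ℝ) - A ≤ L) :
    ∃ T, 0 ≤ T ∧ T ≤ L ∧ (T ≤ √(L * max τ 1) ∨
        (distInt θ * T ^ 2 ≤ 2 * k * L ∧ δ * τ * T ^ 2 ≤ L)) ∧
      ∀ b ≤ B, ‖∑ n ∈ Finset.Ico A b, e (φ n)‖ ≤ 40 * k ^ 2 * T := by
  rcases hε with rfl | rfl
  · exact exists_sum_bound_of_phase_pos hk hL hτ hδ₀ hδ hφ (by simpa using hsep) hρ hcard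
  · have := exists_sum_bound_of_phase_pos (φ := fun z => -φ z) (φ' := fun z => -φ' z) (θ := -θ)
      hk hL hτ hδ₀ hδ (fun z hz => (hφ z hz).neg)
      (fun x hx y hy hxy => by linarith [hsep x hx y hy hxy])
      (fun z hz => by
        have := hρ z hz
        rwa [← abs_neg, show -(-φ' z - -θ) = φ' z - θ by ring]) hcard
    simpa only [distInt_neg, norm_sum_e_neg] using this

end Phase
-- Closed formulas for stationary points, phases and amplitudes.
/-- `√(1 + b κ / z)`, in terms of which the stationary points, amplitudes and phases are expressed. -/
def rootFactor (b κ z : ℝ) : ℝ := √(1 + b * κ / z)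

section RootFactor

variable {b κ z : ℝ}

theorem rootFactor_sq (hb : 0 ≤ b) (hκ : 0 ≤ κ) (hz : 0 ≤ z) :
    rootFactor b κ z ^ 2 = 1 + b * κ / z := Real.sq_sqrt (by positivity)

theorem one_lt_rootFactor (hb : 0 < b) (hκ : 0 < κ) (hz : 0 < z) : 1 < rootFactor b κ z := by
  rw [rootFactor, Real.lt_sqrt zero_le_one]
  have : 0 < b * κ / z := by positivity
  linarith

theorem rootFactor_antitoneOn (hb : 0 ≤ b) (hκ : 0 ≤ κ) :
    AntitoneOn (rootFactor b κ) (Set.Ioi 0) := by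
  intro x hx y hy hxy
  rw [Set.mem_Ioi] at hx hy
  refine Real.sqrt_le_sqrt ?_
  have : b * κ / y ≤ b * κ / x := div_le_div_of_nonneg_left (by positivity) hx hxy
  linarith

theorem hasDerivAt_rootFactor (hb : 0 ≤ b) (hκ : 0 ≤ κ) (hz : 0 < z) :
    HasDerivAt (rootFactor b κ) (-(b * κ / z ^ 2) / (2 * rootFactor b κ z)) z := by
  have h1 : HasDerivAt (fun z => 1 + b * κ / z) (-(b * κ / z ^ 2)) z := by
    have := ((hasDerivAt_inv hz.ne').const_mul (b * κ)).const_add 1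
    refine this.congr_deriv ?_
    ring
  exact h1.sqrt (by positivity)

theorem rootFactor_div {r : ℝ} (b κ z : ℝ) : rootFactor b κ (z / r) = rootFactor (b * r) κ z := by
  simp only [rootFactor]
  congr 2
  rw [div_div_eq_mul_div]
  ring

end RootFactor

section Formulas

variable {t u v q d σ y : ℝ}

theorem sqrt_add_eq (ht : 0 < t) (hu : 0 < u) (hq : 0 < q) (hd : 0 < d) (hy : 0 < y) :
    √(y + 2 * t * u * q / (Real.pi * d)) = √y * rootFactor (2 * t / Real.pi) (u * q / d) y := by
  have := Real.pi_pos
  rw [rootFactor, ← Real.sqrt_mul hy.le]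
  congr 1
  field_simp

theorem stationary_pos (hσ : σ = 1 ∨ σ = -1) {s : ℝ} (hs : 1 < s) : 0 < s + σ := by
  rcases hσ with rfl | rfl <;> linarith

/-- The phase as a function of `y`, with its derivative. -/
theorem hasDerivAt_phase (hσ : σ = 1 ∨ σ = -1) (ht : 0 < t) (hu : 0 < u) (hq : 0 < q) (hd : 0 < d)
    (hv : v = q * d) (hy : 0 < y) (x : ℝ → ℝ)
    (hx : x = fun y => (d / (2 * u)) ^ 2
      * (√(y + 2 * t * u * q / (Real.pi * d)) + σ * √y) ^ 2) (k : ℝ) :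
    HasDerivAt (fun y => -t / (2 * Real.pi) * Real.log (x y) + u / v * x y
        - σ * (2 / q * √(y * x y)) + 1 / 8 - k)
      (-σ * (rootFactor (2 * t / Real.pi) (u * q / d) y + σ) / (2 * (u * q / d))) y := by
  have hpi := Real.pi_pos
  have hrf := sqrt_add_eq ht hu hq hd hy
  have hs := one_lt_rootFactor (b := 2 * t / Real.pi) (κ := u * q / d) (by positivity)
    (by positivity) hy
  set s := rootFactor (2 * t / Real.pi) (u * q / d) y
  set A := 2 * t * u * q / (Real.pi * d) with hA
  have hA0 : 0 < A := by positivity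
  have hY : 0 < √y := Real.sqrt_pos.2 hy
  have hZ : 0 < √(y + A) := Real.sqrt_pos.2 (by positivity)
  have hY2 : √y ^ 2 = y := Real.sq_sqrt hy.le
  have hZ2 : √(y + A) ^ 2 = y + A := Real.sq_sqrt (by positivity)
  have hp : 0 < √(y + A) + σ * √y := by
    have := stationary_pos hσ hs
    rw [hrf]
    nlinarith
  have hdp : HasDerivAt (fun y => √(y + A) + σ * √y)
      (1 / (2 * √(y + A)) + σ * (1 / (2 * √y))) y := by
    refine HasDerivAt.add ?_ ?_
    · exact ((hasDerivAt_id y).add_const A).sqrt (by simp; positivity)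
    · exact ((hasDerivAt_id y).sqrt hy.ne').const_mul σ
  have hdx : HasDerivAt x ((d / (2 * u)) ^ 2 * (2 * (√(y + A) + σ * √y)
      * (1 / (2 * √(y + A)) + σ * (1 / (2 * √y))))) y := by
    rw [hx]
    have := (hdp.pow 2).const_mul ((d / (2 * u)) ^ 2)
    simpa using this
  have hxy : x y = (d / (2 * u)) ^ 2 * (√(y + A) + σ * √y) ^ 2 := by rw [hx]
  have hx0 : 0 < x y := by rw [hxy]; positivity
  have hsx : √(y * x y) = √y * ((d / (2 * u)) * (√(y + A) + σ * √y)) := by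
    rw [Real.sqrt_mul hy.le, hxy, ← mul_pow, Real.sqrt_sq (by positivity)]
  have hder := ((((hdx.log hx0.ne').const_mul (-t / (2 * Real.pi))).add
    (hdx.const_mul (u / v))).sub
    (((((hasDerivAt_id y).mul hdx).sqrt (by simpa using ⟨hy.ne', hx0.ne'⟩)).const_mul
      (2 / q)).const_mul σ)).add_const (1 / 8) |>.sub_const k
  -- As `x y` is a stationary point of the phase, the contributions of its derivative cancel and `-σ
  -- √(x y / y) / q` remains. Eliminating `t` and `A` in favour of the two square roots makes this a
  -- rational identity.
  refine hder.congr_deriv ?_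
  simp only [id, one_mul, Pi.mul_apply]
  rw [hsx, hxy, hv]
  have hsY : s = √(y + A) / √y := by rw [hrf]; field_simp
  rw [hsY]
  have ht' : t = A * (Real.pi * d) / (2 * u * q) := by rw [hA]; field_simp
  have hA' : A = √(y + A) ^ 2 - √y ^ 2 := by rw [hZ2, hY2]; ring
  clear_value A
  rw [ht']
  have hder2 : y = √y ^ 2 := hY2.symm
  generalize √(y + A) = Z at *
  generalize √y = Y at *
  subst hder2
  subst hA'
  have hp' : Z + σ * Y ≠ 0 := hp.ne'
  rcases hσ with rfl | rfl
  · field_simp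
    ring
  · have : Z - Y ≠ 0 := by intro h; apply hp'; linarith
    rw [show Z + -1 * Y = Z - Y by ring] at *
    field_simp
    ring

theorem stationary_eq (ht : 0 < t) (hu : 0 < u) (hq : 0 < q) (hd : 0 < d) (hy : 0 < y) (σ : ℝ) :
    (d / (2 * u)) ^ 2 * (√(y + 2 * t * u * q / (Real.pi * d)) + σ * √y) ^ 2
      = (d / (2 * u) * (√y * (rootFactor (2 * t / Real.pi) (u * q / d) y + σ))) ^ 2 := by
  rw [sqrt_add_eq ht hu hq hd hy]
  ring

/-- Eliminating `t` through `s² - 1 = 2 t κ / (π y)`, where `κ = u q / d`, makes the base of the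
power the square of the reciprocal of the right-hand side. -/
theorem amplitude_eq (hσ : σ = 1 ∨ σ = -1) (ht : 0 < t) (hu : 0 < u) (hq : 0 < q) (hd : 0 < d)
    (hy : 0 < y) (x : ℝ)
    (hx : x = (d / (2 * u)) ^ 2 * (√(y + 2 * t * u * q / (Real.pi * d)) + σ * √y) ^ 2) :
    (q * t * √y / (Real.pi * x ^ (3 / 2 : ℝ)) + σ * (y / x)) ^ (-(1 / 2) : ℝ)
      = d / (2 * u) * ((rootFactor (2 * t / Real.pi) (u * q / d) y + σ)
        / √(rootFactor (2 * t / Real.pi) (u * q / d) y)) := by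
  have hpi := Real.pi_pos
  rw [stationary_eq ht hu hq hd hy] at hx
  have hs := one_lt_rootFactor (b := 2 * t / Real.pi) (κ := u * q / d) (by positivity)
    (by positivity) hy
  have hs2 := rootFactor_sq (b := 2 * t / Real.pi) (κ := u * q / d) (z := y) (by positivity)
    (by positivity) hy.le
  set s := rootFactor (2 * t / Real.pi) (u * q / d) y
  have hp := stationary_pos hσ hs
  have hY : 0 < √y := Real.sqrt_pos.2 hy
  have hY2 : √y ^ 2 = y := Real.sq_sqrt hy.le
  have hS : 0 < √s := Real.sqrt_pos.2 (by linarith)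
  have hS2 : √s ^ 2 = s := Real.sq_sqrt (by linarith)
  set w := d / (2 * u) * (√y * (s + σ)) with hw
  have hw0 : 0 < w := by positivity
  have hx32 : x ^ (3 / 2 : ℝ) = w ^ 3 := by
    rw [hx, ← Real.rpow_natCast w 2, ← Real.rpow_mul hw0.le, ← Real.rpow_natCast w 3]
    norm_num
  have hbase : q * t * √y / (Real.pi * x ^ (3 / 2 : ℝ)) + σ * (y / x)
      = (d / (2 * u) * ((s + σ) / √s))⁻¹ ^ 2 := by
    have hinv : (d / (2 * u) * ((s + σ) / √s))⁻¹ ^ 2 = ((d / (2 * u)) ^ 2 * ((s + σ) ^ 2 / s))⁻¹ := by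
      rw [inv_pow, mul_pow (d / (2 * u)), div_pow (s + σ), hS2]
    rw [hx32, hx, hinv]
    have ht' : t = (s ^ 2 - 1) * y * Real.pi * d / (2 * (u * q)) := by
      rw [hs2]; field_simp; ring
    rw [ht', hw, ← hY2, Real.sqrt_sq hY.le]
    field_simp
    rcases hσ with rfl | rfl
    · ring
    · ring
  rw [hbase, ← Real.rpow_natCast, ← Real.rpow_mul (by positivity)]
  norm_num
  rw [Real.rpow_neg_one]
  simp

end Formulas

/-! ### Size of the derivatives of a difference of two phases. -/

/-- From `(√(1 + X) - 1) (√(1 + X) + 1) = X ≍ Q ≫ 1`, the root minus one is still of order `√Q`.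
Hence `s - σ` has the same order for both signs. -/
theorem exists_sqrt_one_add_bounds {m₀ C₁ : ℝ} (hm₀ : 0 < m₀) (hC₁ : 1 ≤ C₁) :
    ∃ k : ℝ, 1 ≤ k ∧ ∀ Q X : ℝ, m₀ ≤ Q → Q ≤ C₁ * X → X ≤ C₁ * Q →
      √Q ≤ k * (√(1 + X) - 1) ∧ √(1 + X) ≤ k * √Q := by
  set k₂ := √(1 / m₀ + C₁) with hk₂
  have hk₂1 : 1 ≤ k₂ := by
    rw [hk₂, Real.one_le_sqrt]
    have : 0 < 1 / m₀ := by positivity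
    linarith
  refine ⟨2 * C₁ * k₂, by nlinarith, fun Q X h1 h2 h3 => ?_⟩
  have hQ : 0 < Q := hm₀.trans_le h1
  have hX : 0 < X := by nlinarith
  have hup : √(1 + X) ≤ k₂ * √Q := by
    rw [hk₂, ← Real.sqrt_mul (by positivity)]
    refine Real.sqrt_le_sqrt ?_
    have : 1 ≤ 1 / m₀ * Q := by rw [one_div, ← div_eq_inv_mul, le_div_iff₀ hm₀]; linarith
    linarith
  have hs : √(1 + X) ^ 2 = 1 + X := Real.sq_sqrt (by positivity)
  have hQ2 : √Q ^ 2 = Q := Real.sq_sqrt hQ.le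
  have hs1 : 1 ≤ √(1 + X) := by rw [Real.one_le_sqrt]; linarith
  have hq : 0 < √Q := Real.sqrt_pos.2 hQ
  constructor
  · have h4 : √Q ^ 2 ≤ C₁ * ((√(1 + X) - 1) * (√(1 + X) + 1)) := by nlinarith
    have h5 : (√(1 + X) - 1) * (√(1 + X) + 1) ≤ (√(1 + X) - 1) * (2 * (k₂ * √Q)) :=
      mul_le_mul_of_nonneg_left (by linarith) (by linarith)
    have h6 : √Q * √Q ≤ 2 * C₁ * k₂ * (√(1 + X) - 1) * √Q := by nlinarith
    exact le_of_mul_le_mul_right h6 hq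
  · have : k₂ * √Q ≤ 2 * C₁ * k₂ * √Q := by
      have : 0 ≤ k₂ * √Q := by positivity
      nlinarith
    linarith

theorem rootFactor_sub {b κ₁ κ₂ z : ℝ} (hb : 0 < b) (h1 : 0 < κ₁) (h2 : 0 < κ₂) (hz : 0 < z) :
    rootFactor b κ₁ z - rootFactor b κ₂ z
      = b * (κ₁ - κ₂) / (z * (rootFactor b κ₁ z + rootFactor b κ₂ z)) := by
  have e1 := rootFactor_sq hb.le h1.le hz.le
  have e2 := rootFactor_sq hb.le h2.le hz.le
  have p1 := one_lt_rootFactor hb h1 hz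
  have p2 := one_lt_rootFactor hb h2 hz
  have : 0 < rootFactor b κ₁ z + rootFactor b κ₂ z := by linarith
  rw [eq_div_iff (by positivity)]
  have e3 : rootFactor b κ₁ z ^ 2 - rootFactor b κ₂ z ^ 2 = b * (κ₁ - κ₂) / z := by
    rw [e1, e2]; ring
  rw [eq_div_iff hz.ne'] at e3
  linarith

theorem rootFactor_add_div {b κ z σ : ℝ} (hσ : σ = 1 ∨ σ = -1) (hb : 0 < b) (hκ : 0 < κ)
    (hz : 0 < z) :
    (rootFactor b κ z + σ) / κ = b / z / (rootFactor b κ z - σ) := by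
  have e1 := rootFactor_sq hb.le hκ.le hz.le
  have p1 := one_lt_rootFactor hb hκ hz
  have : 0 < rootFactor b κ z - σ := by rcases hσ with rfl | rfl <;> linarith
  rw [div_eq_div_iff hκ.ne' this.ne']
  have hσ2 : σ ^ 2 = 1 := by rcases hσ with rfl | rfl <;> norm_num
  have : (rootFactor b κ z + σ) * (rootFactor b κ z - σ) = rootFactor b κ z ^ 2 - σ ^ 2 := by ring
  rw [this, e1, hσ2]
  ring

/-- Derivative in `z` of the difference of two phases, without the sign. -/
def phaseDeriv (b r σ κ₁ κ₂ z : ℝ) : ℝ :=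
  ((rootFactor b κ₁ z + σ) / κ₁ - (rootFactor b κ₂ z + σ) / κ₂) / (2 * r)

/-- Rationalizing twice extracts the factor `κ₂ - κ₁` and leaves only positive factors, so the size
can be read off without cancellation. -/
theorem phaseDeriv_eq {b r σ κ₁ κ₂ z : ℝ} (hσ : σ = 1 ∨ σ = -1) (hb : 0 < b) (hr : 0 < r)
    (h1 : 0 < κ₁) (h2 : 0 < κ₂) (hz : 0 < z) :
    phaseDeriv b r σ κ₁ κ₂ z = b ^ 2 * (κ₂ - κ₁) / (2 * r * z ^ 2 *
      (rootFactor b κ₁ z + rootFactor b κ₂ z) * (rootFactor b κ₁ z - σ)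
        * (rootFactor b κ₂ z - σ)) := by
  have p1 := one_lt_rootFactor hb h1 hz
  have p2 := one_lt_rootFactor hb h2 hz
  have q1 : 0 < rootFactor b κ₁ z - σ := by rcases hσ with rfl | rfl <;> linarith
  have q2 : 0 < rootFactor b κ₂ z - σ := by rcases hσ with rfl | rfl <;> linarith
  have q3 : 0 < rootFactor b κ₁ z + rootFactor b κ₂ z := by linarith
  have e := rootFactor_sub hb h2 h1 hz
  rw [phaseDeriv, rootFactor_add_div hσ hb h1 hz, rootFactor_add_div hσ hb h2 hz]
  have : b / z / (rootFactor b κ₁ z - σ) - b / z / (rootFactor b κ₂ z - σ)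
      = b / z * (rootFactor b κ₂ z - rootFactor b κ₁ z)
        / ((rootFactor b κ₁ z - σ) * (rootFactor b κ₂ z - σ)) := by
    field_simp
    ring
  rw [this, e]
  rw [add_comm (rootFactor b κ₂ z)]
  field_simp

/-- In this form the derivative visibly has the constant sign of `κ₁ - κ₂`. -/
theorem hasDerivAt_phaseDeriv {b r σ κ₁ κ₂ z : ℝ} (hb : 0 < b) (hr : 0 < r)
    (h1 : 0 < κ₁) (h2 : 0 < κ₂) (hz : 0 < z) :
    HasDerivAt (phaseDeriv b r σ κ₁ κ₂)
      (b ^ 2 * (κ₁ - κ₂) / (4 * r * z ^ 3 * (rootFactor b κ₁ z * rootFactor b κ₂ z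
        * (rootFactor b κ₁ z + rootFactor b κ₂ z)))) z := by
  have p1 := one_lt_rootFactor hb h1 hz
  have p2 := one_lt_rootFactor hb h2 hz
  have q3 : 0 < rootFactor b κ₁ z + rootFactor b κ₂ z := by linarith
  have e := rootFactor_sub hb h1 h2 hz
  have hd := ((((hasDerivAt_rootFactor hb.le h1.le hz).add_const σ).div_const κ₁).sub
    (((hasDerivAt_rootFactor hb.le h2.le hz).add_const σ).div_const κ₂)).div_const (2 * r)
  refine hd.congr_deriv ?_
  have : -(b * κ₁ / z ^ 2) / (2 * rootFactor b κ₁ z) / κ₁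
        - -(b * κ₂ / z ^ 2) / (2 * rootFactor b κ₂ z) / κ₂
      = b / (2 * z ^ 2) * (rootFactor b κ₁ z - rootFactor b κ₂ z)
        / (rootFactor b κ₁ z * rootFactor b κ₂ z) := by
    field_simp
    ring
  rw [this, e]
  field_simp
  ring

/-- Here `q` stands for `√(b K₀ / L)`. Each of the three root factors in the denominator is `≫ q`,
and `b² / (r z² q³)` is of order `q / (r K₀²)`. -/
theorem abs_phaseDeriv_le {b r σ κ₁ κ₂ z q k C₀ K₀ L : ℝ} (hσ : σ = 1 ∨ σ = -1) (hb : 0 < b)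
    (hr : 0 < r) (hκ₁ : 0 < κ₁) (hκ₂ : 0 < κ₂) (hz : 0 < z) (hq : 0 < q) (hk : 1 ≤ k)
    (hC₀ : 1 ≤ C₀) (hK₀ : 0 < K₀) (hL : 0 < L) (hbq : b = q ^ 2 * L / K₀) (hLz : L ≤ C₀ * z)
    (l1 : q ≤ k * (rootFactor b κ₁ z - 1)) (l2 : q ≤ k * (rootFactor b κ₂ z - 1)) :
    |phaseDeriv b r σ κ₁ κ₂ z| ≤ C₀ ^ 2 * k ^ 3 * (|κ₁ - κ₂| / K₀ * (q / (r * K₀))) := by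
  rw [phaseDeriv_eq hσ hb hr hκ₁ hκ₂ hz]
  set s₁ := rootFactor b κ₁ z
  set s₂ := rootFactor b κ₂ z
  have g1 : q ≤ k * (s₁ - σ) := by
    refine l1.trans (mul_le_mul_of_nonneg_left ?_ (by linarith))
    rcases hσ with rfl | rfl <;> linarith
  have g2 : q ≤ k * (s₂ - σ) := by
    refine l2.trans (mul_le_mul_of_nonneg_left ?_ (by linarith))
    rcases hσ with rfl | rfl <;> linarith
  have g3 : q ≤ k * (s₁ + s₂) := by
    have : 0 ≤ k * (s₂ - 1) := hq.le.trans l2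
    linarith
  have hk0 : 0 < k := by linarith
  have p1 : 0 < s₁ - σ := pos_of_mul_pos_right (hq.trans_le g1) hk0.le
  have p2 : 0 < s₂ - σ := pos_of_mul_pos_right (hq.trans_le g2) hk0.le
  have p3 : 0 < s₁ + s₂ := pos_of_mul_pos_right (hq.trans_le g3) hk0.le
  rw [abs_div, abs_mul, abs_sub_comm κ₂, abs_of_pos (by positivity : 0 < b ^ 2),
    abs_of_pos (by positivity : 0 < 2 * r * z ^ 2 * (s₁ + s₂) * (s₁ - σ) * (s₂ - σ)),
    div_le_iff₀ (by positivity)]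
  have hden : r * L ^ 2 * q ^ 3 ≤
      (C₀ ^ 2 * k ^ 3) * (r * z ^ 2 * (s₁ + s₂) * (s₁ - σ) * (s₂ - σ)) := by
    calc r * L ^ 2 * q ^ 3 = r * L ^ 2 * (q * q * q) := by ring
      _ ≤ r * (C₀ * z) ^ 2 * ((k * (s₁ + s₂)) * (k * (s₁ - σ)) * (k * (s₂ - σ))) := by gcongr
      _ = _ := by ring
  set D := r * z ^ 2 * (s₁ + s₂) * (s₁ - σ) * (s₂ - σ) with hD
  have hD0 : 0 < D := by positivity
  have hD2 : 2 * r * z ^ 2 * (s₁ + s₂) * (s₁ - σ) * (s₂ - σ) = 2 * D := by rw [hD]; ring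
  rw [hD2, hbq]
  have hm : 0 ≤ |κ₁ - κ₂| := abs_nonneg _
  generalize |κ₁ - κ₂| = m at *
  clear_value D
  calc (q ^ 2 * L / K₀) ^ 2 * m = q * m / (r * K₀ ^ 2) * (r * L ^ 2 * q ^ 3) := by field_simp
    _ ≤ q * m / (r * K₀ ^ 2) * ((C₀ ^ 2 * k ^ 3) * (2 * D)) := by
        refine mul_le_mul_of_nonneg_left ?_ (by positivity)
        have : 0 ≤ (C₀ ^ 2 * k ^ 3) * D := by positivity
        linarith
    _ = _ := by field_simp

theorem le_deriv_phaseDeriv {b r κ₁ κ₂ z q k C₀ K₀ L m : ℝ} (hb : 0 < b) (hm : 0 ≤ m)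
    (hr : 0 < r) (hκ₁ : 0 < κ₁) (hκ₂ : 0 < κ₂) (hz : 0 < z) (hq : 0 < q) (hk : 1 ≤ k)
    (hC₀ : 1 ≤ C₀) (hK₀ : 0 < K₀) (hL : 0 < L) (hbq : b = q ^ 2 * L / K₀) (hLz : z ≤ C₀ * L)
    (u1 : rootFactor b κ₁ z ≤ k * q) (u2 : rootFactor b κ₂ z ≤ k * q) :
    m / K₀ * (q / (r * K₀)) / (8 * C₀ ^ 3 * k ^ 3 * L)
      ≤ b ^ 2 * m / (4 * r * z ^ 3 * (rootFactor b κ₁ z * rootFactor b κ₂ z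
        * (rootFactor b κ₁ z + rootFactor b κ₂ z))) := by
  have p1 := one_lt_rootFactor hb hκ₁ hz
  have p2 := one_lt_rootFactor hb hκ₂ hz
  set s₁ := rootFactor b κ₁ z
  set s₂ := rootFactor b κ₂ z
  have hden : z ^ 3 * (s₁ * s₂ * (s₁ + s₂)) ≤ 2 * C₀ ^ 3 * k ^ 3 * (L ^ 3 * q ^ 3) := by
    calc z ^ 3 * (s₁ * s₂ * (s₁ + s₂))
        ≤ (C₀ * L) ^ 3 * ((k * q) * (k * q) * (k * q + k * q)) := by gcongr
      _ = _ := by ring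
  have hD0 : 0 < z ^ 3 * (s₁ * s₂ * (s₁ + s₂)) := by positivity
  rw [mul_assoc (4 * r) (z ^ 3)]
  generalize z ^ 3 * (s₁ * s₂ * (s₁ + s₂)) = D at *
  have hk0 : 0 < k := by linarith
  calc m / K₀ * (q / (r * K₀)) / (8 * C₀ ^ 3 * k ^ 3 * L)
      = b ^ 2 * m / (4 * r * (2 * C₀ ^ 3 * k ^ 3 * (L ^ 3 * q ^ 3))) := by
        rw [hbq]; field_simp; ring
    _ ≤ _ := by gcongr

/-- Upper bound for the first and lower bound for the second derivative of the difference of two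
phases. -/
theorem exists_phaseDeriv_bounds {m₀ C₀ : ℝ} (hm₀ : 0 < m₀) (hC₀ : 1 ≤ C₀) :
    ∃ k : ℝ, 1 ≤ k ∧ ∀ b r σ K₀ L κ₁ κ₂ : ℝ, (σ = 1 ∨ σ = -1) → 0 < b → 0 < r → 0 < K₀ → 0 < L →
      m₀ ≤ b * K₀ / L → K₀ ≤ C₀ * κ₁ → κ₁ ≤ K₀ → K₀ ≤ C₀ * κ₂ → κ₂ ≤ K₀ →
      (∀ z, L ≤ C₀ * z → z ≤ C₀ * L →
        rootFactor b κ₁ z ≤ k * √(b * K₀ / L) ∧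
        |phaseDeriv b r σ κ₁ κ₂ z| ≤ k * (|κ₁ - κ₂| / K₀ * (√(b * K₀ / L) / (r * K₀)))) ∧
      ∃ ε : ℝ, (ε = 1 ∨ ε = -1) ∧ ∀ x y, L ≤ C₀ * x → x ≤ y → y ≤ C₀ * L →
        |κ₁ - κ₂| / K₀ * (√(b * K₀ / L) / (r * K₀)) / (k * L) * (y - x)
          ≤ ε * (phaseDeriv b r σ κ₁ κ₂ y - phaseDeriv b r σ κ₁ κ₂ x) := by
  obtain ⟨k, hk, hroot⟩ := exists_sqrt_one_add_bounds (C₁ := C₀ ^ 2) hm₀ (one_le_pow₀ hC₀)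
  have hk3 : 1 ≤ k ^ 3 := one_le_pow₀ hk
  have hC3 : 1 ≤ C₀ ^ 3 := one_le_pow₀ hC₀
  refine ⟨8 * C₀ ^ 3 * k ^ 3, by nlinarith, ?_⟩
  intro b r σ K₀ L κ₁ κ₂ hσ hb hr hK₀ hL hm h1 h1' h2 h2'
  have hκ₁ : 0 < κ₁ := by nlinarith
  have hκ₂ : 0 < κ₂ := by nlinarith
  set Q := b * K₀ / L with hQ
  have hQ0 : 0 < Q := hm₀.trans_le hm
  have hq : 0 < √Q := Real.sqrt_pos.2 hQ0
  have hq2 : √Q ^ 2 = Q := Real.sq_sqrt hQ0.le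
  have hbQ : b = √Q ^ 2 * L / K₀ := by rw [hq2, hQ]; field_simp
  have hs : ∀ κ z, K₀ ≤ C₀ * κ → κ ≤ K₀ → L ≤ C₀ * z → z ≤ C₀ * L →
      √Q ≤ k * (rootFactor b κ z - 1) ∧ rootFactor b κ z ≤ k * √Q := by
    intro κ z a1 a2 a3 a4
    have hκ : 0 < κ := by nlinarith
    have hz : 0 < z := by nlinarith
    refine hroot Q (b * κ / z) hm ?_ ?_
    · rw [hQ, div_le_iff₀ hL, mul_div_assoc', div_mul_eq_mul_div, le_div_iff₀ hz]
      calc b * K₀ * z ≤ b * (C₀ * κ) * (C₀ * L) := by gcongr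
        _ = _ := by ring
    · rw [hQ, div_le_iff₀ hz, mul_div_assoc', div_mul_eq_mul_div, le_div_iff₀ hL]
      calc b * κ * L ≤ b * (C₀ * κ) * (C₀ * z) := by gcongr; nlinarith
        _ = C₀ ^ 2 * (b * κ) * z := by ring
        _ ≤ _ := by gcongr
  constructor
  · intro z a3 a4
    have hz : 0 < z := by nlinarith
    obtain ⟨l1, u1⟩ := hs κ₁ z h1 h1' a3 a4
    obtain ⟨l2, u2⟩ := hs κ₂ z h2 h2' a3 a4
    refine ⟨u1.trans ?_, ?_⟩
    · have : k ≤ 8 * C₀ ^ 3 * k ^ 3 := by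
        have : k ≤ k ^ 3 := by nlinarith [sq_nonneg (k - 1)]
        nlinarith
      gcongr
    refine (abs_phaseDeriv_le hσ hb hr hκ₁ hκ₂ hz hq hk hC₀ hK₀ hL hbQ a3 l1 l2).trans ?_
    refine mul_le_mul_of_nonneg_right ?_ (by positivity)
    refine mul_le_mul_of_nonneg_right ?_ (by positivity)
    nlinarith [sq_nonneg C₀]
  · have main : ∀ ε : ℝ, ε * (κ₁ - κ₂) = |κ₁ - κ₂| → ∀ x y, L ≤ C₀ * x → x ≤ y → y ≤ C₀ * L →
        |κ₁ - κ₂| / K₀ * (√Q / (r * K₀)) / (8 * C₀ ^ 3 * k ^ 3 * L) * (y - x)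
          ≤ ε * (phaseDeriv b r σ κ₁ κ₂ y - phaseDeriv b r σ κ₁ κ₂ x) := by
      intro ε hε x y hx hxy hy
      have hx0 : 0 < x := by nlinarith
      have hd : ∀ z ∈ Set.Icc x y, HasDerivAt (fun z => ε * phaseDeriv b r σ κ₁ κ₂ z)
          (ε * (b ^ 2 * (κ₁ - κ₂) / (4 * r * z ^ 3 * (rootFactor b κ₁ z * rootFactor b κ₂ z
        * (rootFactor b κ₁ z + rootFactor b κ₂ z))))) z := fun z hz =>
        (hasDerivAt_phaseDeriv hb hr hκ₁ hκ₂ (hx0.trans_le hz.1)).const_mul ε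
      have h := (convex_Icc x y).mul_sub_le_image_sub_of_le_deriv
        (C := |κ₁ - κ₂| / K₀ * (√Q / (r * K₀)) / (8 * C₀ ^ 3 * k ^ 3 * L))
        (fun z hz => (hd z hz).continuousAt.continuousWithinAt)
        (fun z hz => (hd z (interior_subset hz)).differentiableAt.differentiableWithinAt)
        (fun z hz => ?_) x ⟨le_rfl, hxy⟩ y ⟨hxy, le_rfl⟩ hxy
      · linarith
      have hz' := interior_subset hz
      rw [(hd z hz').deriv]
      have hz : 0 < z := hx0.trans_le hz'.1
      have a4 : z ≤ C₀ * L := hz'.2.trans hy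
      have a3 : L ≤ C₀ * z := by nlinarith [hz'.1]
      obtain ⟨-, u1⟩ := hs κ₁ z h1 h1' a3 a4
      obtain ⟨-, u2⟩ := hs κ₂ z h2 h2' a3 a4
      rw [mul_div_assoc' ε, show ε * (b ^ 2 * (κ₁ - κ₂)) = b ^ 2 * (ε * (κ₁ - κ₂)) by ring, hε]
      exact le_deriv_phaseDeriv hb (abs_nonneg _) hr hκ₁ hκ₂ hz hq hk hC₀ hK₀ hL hbQ a4 u1 u2
    -- The required `ε` is the sign of `κ₁ - κ₂`.
    rcases le_total 0 (κ₁ - κ₂) with h | h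
    · exact ⟨1, Or.inl rfl, main 1 (by rw [abs_of_nonneg h, one_mul])⟩
    · exact ⟨-1, Or.inr rfl, main (-1) (by rw [abs_of_nonpos h]; ring)⟩

/-! ### The cut-off weights as multipliers. -/

namespace IsMultiplier

variable {A B : ℕ} {w : ℕ → ℝ}

theorem comp_monotone {F : ℝ → ℝ} {W : ℝ} (hF : Monotone F) (hW : ∀ z, |F z| ≤ W)
    (hw : MonotoneOn w (Set.Ico A B) ∨ AntitoneOn w (Set.Ico A B)) :
    IsMultiplier A B (fun n => F (w n)) (3 * W) := by
  have hW₀ : 0 ≤ W := (abs_nonneg _).trans (hW 0)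
  rcases hw with hw | hw
  · exact of_monotoneOn (hF.comp_monotoneOn hw) hW₀ fun n _ _ => hW _
  · exact of_antitoneOn (hF.comp_antitoneOn hw) hW₀ fun n _ _ => hW _

end IsMultiplier

/-- An even power of the sine is not monotone on the ramp. Its positive and negative parts are; the
minus sign inside makes both pieces increasing in `p`. -/
theorem pow_eq_add_max_pow (p : ℝ) {n : ℕ} (hn : n ≠ 0) :
    p ^ n = max p 0 ^ n - (-1) ^ n * -(max (-p) 0 ^ n) := by
  rcases le_total 0 p with h | h
  · rw [max_eq_left h, max_eq_right (by linarith : -p ≤ 0), zero_pow hn]; ring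
  · rw [max_eq_right h, max_eq_left (by linarith : 0 ≤ -p), zero_pow hn]
    rw [neg_pow p]
    have : ((-1 : ℝ) ^ n) * (-1) ^ n = 1 := by rw [← mul_pow]; norm_num
    linear_combination (-p ^ n) * this

namespace Setup

variable (P : Setup)

/-- The sine of the clamped argument, from which the smooth step is built. -/
def ramp (z : ℝ) : ℝ := Real.sin (Real.pi * max (-(P.H : ℝ)) (min z P.H) / (2 * P.H))

theorem abs_ramp_le (z : ℝ) : |P.ramp z| ≤ 1 := Real.abs_sin_le_one _

theorem ramp_monotone (hH : 0 < P.H) : Monotone P.ramp := by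
  intro x y hxy
  have hH' : (0 : ℝ) < P.H := by exact_mod_cast hH
  have hpi := Real.pi_pos
  have hmem : ∀ z : ℝ, Real.pi * max (-(P.H : ℝ)) (min z P.H) / (2 * P.H)
      ∈ Set.Icc (-(Real.pi / 2)) (Real.pi / 2) := by
    intro z
    have h1 : -(P.H : ℝ) ≤ max (-(P.H : ℝ)) (min z P.H) := le_max_left _ _
    have h2 : max (-(P.H : ℝ)) (min z P.H) ≤ P.H := max_le (by linarith) (min_le_right _ _)
    constructor
    · rw [le_div_iff₀ (by positivity)]; nlinarith
    · rw [div_le_iff₀ (by positivity)]; nlinarith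
  refine Real.strictMonoOn_sin.monotoneOn (hmem x) (hmem y) ?_
  gcongr

/-- For even `s + 1` the power equals `1` to the left of `-H`, where the step must vanish; the
indicator enforces this. -/
theorem step_eq (hH : 0 < P.H) (z : ℝ) :
    P.step z = (if -(P.H : ℝ) < z then 1 else 0) * (1 / 2 + 1 / 2 *
      (max (P.ramp z) 0 ^ (P.s + 1) - (-1) ^ (P.s + 1) * -(max (-P.ramp z) 0 ^ (P.s + 1)))) := by
  have hH' : (0 : ℝ) < P.H := by exact_mod_cast hH
  rw [← pow_eq_add_max_pow _ (by omega : P.s + 1 ≠ 0), step]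
  split_ifs with h1 h2 h3 h3 h3
  · have : P.ramp z = 1 := by
      rw [ramp, min_eq_right h1, max_eq_right (by linarith),
        show Real.pi * (P.H : ℝ) / (2 * P.H) = Real.pi / 2 by field_simp, Real.sin_pi_div_two]
    rw [this]; norm_num
  · linarith
  · linarith
  · simp
  · have : P.ramp z = Real.sin (Real.pi * z / (2 * P.H)) := by
      rw [ramp, min_eq_left (not_le.1 h1).le, max_eq_right h3.le]
    rw [this]; ring
  · linarith

theorem isMultiplier_step (hH : 0 < P.H) {A B : ℕ} {w : ℕ → ℝ}
    (hw : MonotoneOn w (Set.Ico A B) ∨ AntitoneOn w (Set.Ico A B)) :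
    IsMultiplier A B (fun n => P.step (w n)) 11 := by
  have hr := P.ramp_monotone hH
  have hp : ∀ x : ℝ, |x| ≤ 1 → |max x 0 ^ (P.s + 1)| ≤ 1 := by
    intro x hx
    rw [abs_of_nonneg (pow_nonneg (le_max_right _ _) _)]
    exact pow_le_one₀ (le_max_right _ _) (max_le (abs_le.1 hx).2 zero_le_one)
  have m1 : IsMultiplier A B (fun n => if -(P.H : ℝ) < w n then (1 : ℝ) else 0) (3 * 1) := by
    refine IsMultiplier.comp_monotone (F := fun z => if -(P.H : ℝ) < z then (1 : ℝ) else 0)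
      (fun x y hxy => ?_) (fun z => ?_) hw
    · simp only
      split_ifs with h1 h2 h2
      · exact le_rfl
      · exact absurd (h1.trans_le hxy) h2
      · exact zero_le_one
      · exact le_rfl
    · split_ifs <;> simp
  have m2 : IsMultiplier A B (fun n => max (P.ramp (w n)) 0 ^ (P.s + 1)) (3 * 1) := by
    refine IsMultiplier.comp_monotone (F := fun z => max (P.ramp z) 0 ^ (P.s + 1))
      (fun x y hxy => ?_) (fun z => hp _ (P.abs_ramp_le z)) hw
    exact pow_le_pow_left₀ (le_max_right _ _) (max_le_max_right _ (hr hxy)) _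
  have m3 : IsMultiplier A B (fun n => -(max (-P.ramp (w n)) 0 ^ (P.s + 1))) (3 * 1) := by
    refine IsMultiplier.comp_monotone (F := fun z => -(max (-P.ramp z) 0 ^ (P.s + 1)))
      (fun x y hxy => ?_) (fun z => ?_) hw
    · exact neg_le_neg (pow_le_pow_left₀ (le_max_right _ _)
        (max_le_max_right _ (neg_le_neg (hr hxy))) _)
    · rw [abs_neg]
      exact hp _ (by rw [abs_neg]; exact P.abs_ramp_le z)
  -- The constant is `3 (1/2 + (3 + 3)/2) = 10.5`, independent of `s`.
  have m := m1.mul ((IsMultiplier.const (1 / 2)).add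
    ((IsMultiplier.const (1 / 2)).mul (m2.sub ((IsMultiplier.const ((-1) ^ (P.s + 1))).mul m3))))
  refine (m.mono ?_).congr fun n _ _ => P.step_eq hH (w n)
  rw [abs_pow]
  norm_num

theorem isMultiplier_ω (hH : 0 < P.H) (j : ℕ) {A B : ℕ} {w : ℕ → ℝ}
    (hw : MonotoneOn w (Set.Ico A B) ∨ AntitoneOn w (Set.Ico A B)) :
    IsMultiplier A B (fun n => P.ω j (w n)) 22 := by
  have hw' : ∀ k : ℝ, MonotoneOn (fun n => w n - k) (Set.Ico A B)
      ∨ AntitoneOn (fun n => w n - k) (Set.Ico A B) := fun k =>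
    hw.imp (fun h x hx y hy hxy => sub_le_sub_right (h hx hy hxy) k)
      (fun h x hx y hy hxy => sub_le_sub_right (h hx hy hxy) k)
  refine ((P.isMultiplier_step hH (hw' (P.cut (j - 1)))).sub
    (P.isMultiplier_step hH (hw' (P.cut j)))).mono ?_
  norm_num

/-! ### Arithmetic of the Farey data. -/

theorem v_pos (j : ℕ) : 0 < P.v j := (P.α j).den_pos

theorem exists_v_eq (j : ℕ) : ∃ m, P.v j = P.d j * m ∧ (P.d j).Coprime m := by
  refine ⟨∏ p ∈ (P.v j).primeFactors with ¬ (P.v j).factorization p < P.N.factorization p,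
    p ^ (P.v j).factorization p, ?_, ?_⟩
  · rw [d, Finset.prod_filter_mul_prod_filter_not]
    exact (Nat.prod_factorization_pow_eq_self (P.v_pos j).ne').symm
  · rw [d]
    refine Nat.Coprime.prod_left fun p hp => Nat.Coprime.prod_right fun p' hp' => ?_
    rw [Finset.mem_filter] at hp hp'
    refine Nat.coprime_pow_primes _ _ (Nat.prime_of_mem_primeFactors hp.1)
      (Nat.prime_of_mem_primeFactors hp'.1) ?_
    rintro rfl
    exact hp'.2 hp.2

theorem d_pos (j : ℕ) : 0 < P.d j := by
  obtain ⟨m, hm, -⟩ := P.exists_v_eq j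
  have := P.v_pos j
  rw [hm] at this
  exact Nat.pos_of_mul_pos_right this

theorem v_eq (j : ℕ) : P.v j = P.q j * P.d j := by
  obtain ⟨m, hm, -⟩ := P.exists_v_eq j
  rw [q, Nat.div_mul_cancel ⟨m, hm⟩]

theorem coprime_q_d (j : ℕ) : (P.q j).Coprime (P.d j) := by
  obtain ⟨m, hm, h⟩ := P.exists_v_eq j
  rw [q, hm, Nat.mul_div_cancel_left _ (P.d_pos j)]
  exact h.symm

theorem q_pos (j : ℕ) : 0 < P.q j := by
  have := P.v_pos j
  rw [P.v_eq j] at this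
  exact pos_of_mul_pos_left this (Nat.zero_le _)

/-- Modulo `d_j` both `u_j` and `q_j` are units, the first because `d_j` divides `v_j`. -/
theorem coprime_c_d (j : ℕ) : (P.c j).Coprime (P.d j) := by
  have : NeZero (P.d j) := ⟨(P.d_pos j).ne'⟩
  rw [← ZMod.isUnit_iff_coprime, c, ZMod.natCast_zmod_val]
  refine IsUnit.mul ?_ ?_
  · rw [u]
    push_cast
    rw [neg_neg, ZMod.coe_int_isUnit_iff_isCoprime]
    have h1 : IsCoprime ((P.v j : ℕ) : ℤ) (P.α j).num := by
      rw [Int.isCoprime_iff_gcd_eq_one, Int.gcd_comm]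
      exact (P.α j).reduced
    have hdvd : P.d j ∣ P.v j := ⟨P.q j, by rw [P.v_eq j, mul_comm]⟩
    exact h1.of_isCoprime_of_dvd_left (by exact_mod_cast hdvd)
  · exact IsUnit.of_mul_eq_one_right _ (ZMod.coe_mul_inv_eq_one _ (P.coprime_q_d j))

/-- Consequently `d_j` is the same for all indices with a given `β`, which lets `κ_i - κ_j` be
expressed through `u_i v_i - u_j v_j`. -/
theorem den_β (j : ℕ) : (P.β j).den = P.d j := by
  have h := Rat.den_div_eq_of_coprime (a := P.c j) (b := P.d j) (by exact_mod_cast P.d_pos j)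
    (by simpa using P.coprime_c_d j)
  have h2 : P.β j = ((P.c j : ℤ) : ℚ) / ((P.d j : ℤ) : ℚ) := by rw [β]; push_cast; rfl
  rw [← h2] at h
  exact_mod_cast h

/-- For `1 ≤ j ≤ J` the default value `0` of the list lookup is never reached, and the sorted list
has no repetitions. -/
theorem uv_injOn : Set.InjOn (fun j => (P.u j, (P.v j : ℤ))) (Set.Icc 1 P.J) := by
  intro i hi j hj hij
  simp only [Prod.mk.injEq, u, v, neg_inj, Nat.cast_inj] at hij
  have h : P.α i = P.α j := Rat.ext hij.1 hij.2
  have hlen : (P.fareySet_finite.toFinset.sort (· ≤ ·)).length = P.J := Finset.length_sort _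
  have hi' : i - 1 < (P.fareySet_finite.toFinset.sort (· ≤ ·)).length := by
    rw [hlen]; have := hi.1; have := hi.2; omega
  have hj' : j - 1 < (P.fareySet_finite.toFinset.sort (· ≤ ·)).length := by
    rw [hlen]; have := hj.1; have := hj.2; omega
  rw [α, α, List.getD_eq_getElem _ _ hi', List.getD_eq_getElem _ _ hj',
    (Finset.sort_nodup _ _).getElem_inj_iff] at h
  have := hi.1
  have := hj.1
  omega

end Setup

/-! ### The indices with `(u_j, v_j) ∈ ℛ`. -/

section Index

variable {P : Setup} {b : ℚ} {r U₁ U₂ V₁ V₂ : ℕ}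

theorem card_idxIn_le : (idxIn P b r U₁ U₂ V₁ V₂).card ≤ (pairs b U₁ U₂ V₁ V₂).card := by
  refine Finset.card_le_card_of_injOn (fun j => (P.u j, (P.v j : ℤ)))
    (fun j hj => (Finset.mem_filter.1 hj).2) (P.uv_injOn.mono fun j hj => ?_)
  have h := (Finset.mem_filter.1 (Finset.mem_filter.1 hj).1).1
  rw [Finset.mem_Icc] at h
  exact h

theorem mem_idx_of_mem_idxIn {j : ℕ} (hj : j ∈ idxIn P b r U₁ U₂ V₁ V₂) : j ∈ P.idx b r :=
  (Finset.mem_filter.1 hj).1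

theorem d_eq_den {j : ℕ} (hj : j ∈ idxIn P b r U₁ U₂ V₁ V₂) : P.d j = b.den := by
  rw [← (Finset.mem_filter.1 (mem_idx_of_mem_idxIn hj)).2.1, P.den_β]

theorem bounds_of_mem_idxIn {j : ℕ} (hj : j ∈ idxIn P b r U₁ U₂ V₁ V₂) :
    (U₁ : ℝ) ≤ P.u j ∧ (P.u j : ℝ) ≤ U₂ ∧ (V₁ : ℝ) ≤ P.v j ∧ (P.v j : ℝ) ≤ V₂ := by
  have h := (Finset.mem_filter.1 (Finset.mem_filter.1 hj).2).1
  rw [Finset.mem_product, Finset.mem_Icc, Finset.mem_Icc] at h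
  obtain ⟨⟨h1, h2⟩, h3, h4⟩ := h
  simp only at h3 h4
  exact ⟨by exact_mod_cast h1, by exact_mod_cast h2, by exact_mod_cast h3, by exact_mod_cast h4⟩

end Index

/-! ### Monotonicity of stationary points and amplitudes in `ℓ`. -/

theorem sqrt_add_sub_sqrt_antitoneOn {A : ℝ} (hA : 0 ≤ A) :
    AntitoneOn (fun y => √(y + A) - √y) (Set.Ioi 0) := by
  intro x hx y hy hxy
  rw [Set.mem_Ioi] at hx hy
  have hxp := Real.sqrt_pos.2 hx
  have hyp := Real.sqrt_pos.2 hy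
  have key : ∀ z : ℝ, 0 < z → √(z + A) - √z = A / (√(z + A) + √z) := by
    intro z hz
    have h1 := Real.sqrt_pos.2 hz
    have h2 : 0 ≤ √(z + A) := Real.sqrt_nonneg _
    rw [eq_div_iff (by positivity)]
    have e1 := Real.sq_sqrt hz.le
    have e2 := Real.sq_sqrt (by positivity : 0 ≤ z + A)
    linear_combination e2 - e1
  simp only
  rw [key x hx, key y hy]
  have h2 : 0 ≤ √(x + A) := Real.sqrt_nonneg _
  refine div_le_div_of_nonneg_left hA (by positivity) (add_le_add ?_ ?_) <;>
    exact Real.sqrt_le_sqrt (by linarith)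

theorem stationary_monotoneOn_or_antitoneOn {σ A k : ℝ} (hσ : σ = 1 ∨ σ = -1) (hA : 0 ≤ A) :
    MonotoneOn (fun y => k ^ 2 * (√(y + A) + σ * √y) ^ 2) (Set.Ioi 0) ∨
      AntitoneOn (fun y => k ^ 2 * (√(y + A) + σ * √y) ^ 2) (Set.Ioi 0) := by
  rcases hσ with rfl | rfl
  · left
    intro x hx y hy hxy
    simp only
    gcongr
  · right
    intro x hx y hy hxy
    have h := sqrt_add_sub_sqrt_antitoneOn hA hx hy hxy
    have h0 : √y ≤ √(y + A) := Real.sqrt_le_sqrt (by linarith)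
    simp only [neg_one_mul, ← sub_eq_add_neg] at h ⊢
    gcongr

/-- With `a = √s` the expression is `a + σ / a`, which increases for `a ≥ 1` for either sign. -/
theorem add_div_sqrt_le {σ s s' : ℝ} (hσ : σ = 1 ∨ σ = -1) (hs : 1 ≤ s) (hss' : s ≤ s') :
    (s + σ) / √s ≤ (s' + σ) / √s' := by
  have h1 : 1 ≤ √s := Real.one_le_sqrt.2 hs
  have h2 : √s ≤ √s' := Real.sqrt_le_sqrt hss'
  have e1 := Real.sq_sqrt (by linarith : 0 ≤ s)
  have e2 := Real.sq_sqrt (by linarith : 0 ≤ s')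
  rw [div_le_div_iff₀ (by linarith) (by linarith)]
  generalize √s = a at *
  generalize √s' = a' at *
  subst e1 e2
  have h3 : 0 ≤ (a' - a) * (a * a' - 1) := mul_nonneg (by linarith) (by nlinarith)
  have h4 : 0 ≤ (a' - a) * (a * a' + 1) := mul_nonneg (by linarith) (by nlinarith)
  rcases hσ with rfl | rfl <;> nlinarith

theorem add_div_sqrt_nonneg_le {σ s : ℝ} (hσ : σ = 1 ∨ σ = -1) (hs : 1 ≤ s) :
    0 ≤ (s + σ) / √s ∧ (s + σ) / √s ≤ 2 * √s := by
  have h1 : 1 ≤ √s := Real.one_le_sqrt.2 hs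
  have e1 := Real.sq_sqrt (by linarith : 0 ≤ s)
  constructor
  · refine div_nonneg ?_ (by linarith)
    rcases hσ with rfl | rfl <;> linarith
  · rw [div_le_iff₀ (by linarith)]
    rcases hσ with rfl | rfl <;> nlinarith

namespace Setup

variable {P : Setup} {σ r : ℝ} {j A B : ℕ}

/-- The quantity `u_j q_j / d_j`, on which the phases depend. -/
def κ (P : Setup) (j : ℕ) : ℝ := P.u j * P.q j / P.d j

theorem κ_pos (hu : (0 : ℝ) < P.u j) : 0 < P.κ j := by
  have hq : (0 : ℝ) < P.q j := by exact_mod_cast P.q_pos j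
  have hd : (0 : ℝ) < P.d j := by exact_mod_cast P.d_pos j
  rw [κ]; positivity

theorem κ_eq (P : Setup) (j : ℕ) : P.κ j = P.u j * P.v j / (P.d j : ℝ) ^ 2 := by
  have hd : (0 : ℝ) < P.d j := by exact_mod_cast P.d_pos j
  rw [κ, P.v_eq j]
  push_cast
  field_simp

theorem cast_div_mem_Ioi (hr : 0 < r) (hA : 0 < A) {n : ℕ} (hn : A ≤ n) :
    (n : ℝ) / r ∈ Set.Ioi (0 : ℝ) := by
  have : (0 : ℝ) < n := by exact_mod_cast hA.trans_le hn
  exact div_pos this hr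

theorem isMultiplier_ω_x (hH : 0 < P.H) (hσ : σ = 1 ∨ σ = -1) (ht : 0 < P.t)
    (hu : (0 : ℝ) < P.u j) (hr : 0 < r) (hA : 0 < A) :
    IsMultiplier A B (fun n => P.ω j (P.x σ j ((n : ℝ) / r))) 22 := by
  have hq : (0 : ℝ) < P.q j := by exact_mod_cast P.q_pos j
  have hd : (0 : ℝ) < P.d j := by exact_mod_cast P.d_pos j
  have hpi := Real.pi_pos
  refine P.isMultiplier_ω hH j ?_
  have h := stationary_monotoneOn_or_antitoneOn (k := (P.d j : ℝ) / (2 * P.u j)) hσ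
    (A := 2 * P.t * P.u j * P.q j / (Real.pi * P.d j)) (by positivity)
  refine h.imp (fun h m hm n hn hmn => ?_) (fun h m hm n hn hmn => ?_) <;>
  · refine h (cast_div_mem_Ioi hr hA hm.1) (cast_div_mem_Ioi hr hA hn.1) ?_
    have : (m : ℝ) ≤ n := by exact_mod_cast hmn
    gcongr

theorem h_eq (hσ : σ = 1 ∨ σ = -1) (ht : 0 < P.t) (hu : (0 : ℝ) < P.u j) {y : ℝ} (hy : 0 < y) :
    P.h σ j y = P.d j / (2 * P.u j) * ((rootFactor (2 * P.t / Real.pi) (P.κ j) y + σ)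
        / √(rootFactor (2 * P.t / Real.pi) (P.κ j) y)) :=
  amplitude_eq hσ ht hu (by exact_mod_cast P.q_pos j) (by exact_mod_cast P.d_pos j) hy _ rfl

theorem isMultiplier_h (hσ : σ = 1 ∨ σ = -1) (ht : 0 < P.t) (hu : (0 : ℝ) < P.u j) (hr : 0 < r)
    (hA : 0 < A) {W : ℝ} (hW₀ : 0 ≤ W)
    (hW : ∀ n : ℕ, A ≤ n → n < B →
      P.d j / P.u j * √(rootFactor (2 * P.t / Real.pi * r) (P.κ j) n) ≤ W) :
    IsMultiplier A B (fun n => P.h σ j ((n : ℝ) / r)) (3 * W) := by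
  have hd : (0 : ℝ) < P.d j := by exact_mod_cast P.d_pos j
  have hpi := Real.pi_pos
  have hb : 0 < 2 * P.t / Real.pi := by positivity
  have hs : ∀ n : ℕ, A ≤ n → 1 ≤ rootFactor (2 * P.t / Real.pi) (P.κ j) (n / r) := fun n hn =>
    (one_lt_rootFactor hb (κ_pos hu) (cast_div_mem_Ioi hr hA hn)).le
  refine IsMultiplier.of_antitoneOn (fun m hm n hn hmn => ?_) hW₀ fun n h1 h2 => ?_
  · rw [h_eq hσ ht hu (cast_div_mem_Ioi hr hA hm.1), h_eq hσ ht hu (cast_div_mem_Ioi hr hA hn.1)]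
    have hmn' : (m : ℝ) / r ≤ n / r := by
      have : (m : ℝ) ≤ n := by exact_mod_cast hmn
      gcongr
    refine mul_le_mul_of_nonneg_left (add_div_sqrt_le hσ (hs n hn.1) ?_) (by positivity)
    exact rootFactor_antitoneOn hb.le (κ_pos hu).le (cast_div_mem_Ioi hr hA hm.1)
      (cast_div_mem_Ioi hr hA hn.1) hmn'
  · have h3 := hW n h1 h2
    rw [← rootFactor_div] at h3
    obtain ⟨h4, h5⟩ := add_div_sqrt_nonneg_le hσ (hs n h1)
    rw [h_eq hσ ht hu (cast_div_mem_Ioi hr hA h1), abs_of_nonneg (by positivity)]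
    refine le_trans ?_ h3
    calc P.d j / (2 * P.u j) * ((rootFactor (2 * P.t / Real.pi) (P.κ j) (n / r) + σ)
          / √(rootFactor (2 * P.t / Real.pi) (P.κ j) (n / r)))
        ≤ P.d j / (2 * P.u j) * (2 * √(rootFactor (2 * P.t / Real.pi) (P.κ j) (n / r))) := by
          gcongr
      _ = _ := by field_simp

theorem hasDerivAt_g (hσ : σ = 1 ∨ σ = -1) (ht : 0 < P.t) (hu : (0 : ℝ) < P.u j) {y : ℝ}
    (hy : 0 < y) : HasDerivAt (P.g σ j)
      (-σ * (rootFactor (2 * P.t / Real.pi) (P.κ j) y + σ) / (2 * P.κ j)) y :=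
  hasDerivAt_phase hσ ht hu (by exact_mod_cast P.q_pos j) (by exact_mod_cast P.d_pos j)
    (by rw [P.v_eq j]; push_cast; rfl) hy _ rfl _

theorem hasDerivAt_phase_sub (hσ : σ = 1 ∨ σ = -1) (ht : 0 < P.t) {i : ℕ}
    (hi : (0 : ℝ) < P.u i) (hj : (0 : ℝ) < P.u j) (hr : 0 < r) (θ : ℝ) {z : ℝ} (hz : 0 < z) :
    HasDerivAt (fun z => θ * z + (P.g σ i (z / r) - P.g σ j (z / r)))
      (θ - σ * phaseDeriv (2 * P.t / Real.pi * r) r σ (P.κ i) (P.κ j) z) z := by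
  have hd : ∀ k : ℕ, (0 : ℝ) < P.u k → HasDerivAt (fun z => P.g σ k (z / r))
      (-σ * (rootFactor (2 * P.t / Real.pi * r) (P.κ k) z + σ) / (2 * P.κ k) * (1 / r)) z := by
    intro k hk
    have h := hasDerivAt_g hσ ht hk (div_pos hz hr)
    rw [rootFactor_div] at h
    exact h.comp z ((hasDerivAt_id z).div_const r)
  have h := ((hasDerivAt_id z).const_mul θ).add ((hd i hi).sub (hd j hj))
  refine h.congr_deriv ?_
  have := κ_pos hi
  have := κ_pos hj
  rw [phaseDeriv]
  field_simp
  ring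

end Setup

/-! ### Sizes of the parameters. -/

/-- The part of the hypotheses that is used. -/
structure SieveRange (P : Setup) (c : ℝ) (b : ℚ) (r L₁ L₂ U₁ U₂ V₁ V₂ : ℕ) (L U V : ℝ) : Prop where
  t_pos : 0 < P.t
  M_pos : 0 < P.M
  R_pos : 0 < P.R
  r_pos : 0 < r
  L₁_pos : 0 < L₁
  U₁_pos : 0 < U₁
  V₁_pos : 0 < V₁
  L_le : L ≤ c * L₁
  L₁_le : L₁ ≤ L₂
  L₂_le : (L₂ : ℝ) ≤ L
  U_le : U ≤ c * U₁
  U₁_le : U₁ ≤ U₂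
  U₂_le : (U₂ : ℝ) ≤ U
  V_le : V ≤ c * V₁
  V₁_le : V₁ ≤ V₂
  V₂_le : (V₂ : ℝ) ≤ V
  L_le_mul : L ≤ c * (r * P.M / ((b.den : ℝ) * P.R) ^ 2)
  V_le_mul : V ≤ c * P.R
  U_le_mul : U ≤ c * (P.t * V / P.M)

namespace SieveRange

variable {P : Setup} {c : ℝ} {b : ℚ} {r L₁ L₂ U₁ U₂ V₁ V₂ : ℕ} {L U V : ℝ}
  (h : SieveRange P c b r L₁ L₂ U₁ U₂ V₁ V₂ L U V)

include h

theorem one_le_L : 1 ≤ L := by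
  have : 1 ≤ L₂ := h.L₁_pos.trans_le h.L₁_le
  exact le_trans (by exact_mod_cast this) h.L₂_le

theorem one_le_U : 1 ≤ U := by
  have : 1 ≤ U₂ := h.U₁_pos.trans_le h.U₁_le
  exact le_trans (by exact_mod_cast this) h.U₂_le

theorem one_le_V : 1 ≤ V := by
  have : 1 ≤ V₂ := h.V₁_pos.trans_le h.V₁_le
  exact le_trans (by exact_mod_cast this) h.V₂_le

theorem H_pos : 0 < P.H := by
  have := h.t_pos
  have := h.M_pos
  have := h.R_pos
  rw [Setup.H, Nat.ceil_pos]
  positivity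

theorem eta_pos : 0 < eta P b r L U V := by
  have := h.t_pos
  have := h.one_le_L
  have := h.one_le_U
  have := h.one_le_V
  have : (0 : ℝ) < r := by exact_mod_cast h.r_pos
  have : (0 : ℝ) < b.den := by exact_mod_cast b.den_pos
  exact Real.sqrt_pos.2 (by positivity)

/-- Combining `L d² R² ≪ r M`, `V ≪ R` and `U M ≪ t V` with `U, V ≥ 1` gives `L d² ≪ r t V`. This is
the lower bound `m₀` for `b K₀ / L` in `exists_phaseDeriv_bounds`. -/
theorem le_ratio (hc : 1 ≤ c) :
    1 / (2 * c ^ 4) ≤ 2 * P.t / Real.pi * r * (U * V / (b.den : ℝ) ^ 2) / L := by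
  have ht := h.t_pos
  have hM := h.M_pos
  have hR := h.R_pos
  have hL : 0 < L := by linarith [h.one_le_L]
  have hU : 1 ≤ U := h.one_le_U
  have hV : 1 ≤ V := h.one_le_V
  have hr : (0 : ℝ) < r := by exact_mod_cast h.r_pos
  have hd : (0 : ℝ) < b.den := by exact_mod_cast b.den_pos
  have hc0 : 0 < c := by linarith
  have hpi := Real.pi_pos
  have h1 : L * ((b.den : ℝ) ^ 2 * P.R ^ 2) ≤ c * r * P.M := by
    have := h.L_le_mul
    rw [mul_div_assoc', le_div_iff₀ (by positivity)] at this
    nlinarith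
  have h2 : U * P.M ≤ c * (P.t * V) := by
    have := h.U_le_mul
    rw [mul_div_assoc', le_div_iff₀ hM] at this
    linarith
  have h3 : V ^ 2 ≤ c ^ 2 * P.R ^ 2 := by
    rw [← mul_pow]; exact pow_le_pow_left₀ (by linarith) h.V_le_mul 2
  rw [div_le_div_iff₀ (by positivity) hL]
  have h4 : L * (b.den : ℝ) ^ 2 * (P.M * V ^ 2) ≤ (c ^ 4 * r * P.t * V) * (P.M * V ^ 2) := by
    calc L * (b.den : ℝ) ^ 2 * (P.M * V ^ 2)
        ≤ L * (b.den : ℝ) ^ 2 * (P.M * (c ^ 2 * P.R ^ 2)) := by gcongr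
      _ = c ^ 2 * P.M * (L * ((b.den : ℝ) ^ 2 * P.R ^ 2)) := by ring
      _ ≤ c ^ 2 * P.M * (c * r * P.M) := by gcongr
      _ = c ^ 3 * r * P.M * (1 * P.M) := by ring
      _ ≤ c ^ 3 * r * P.M * (U * P.M) := by gcongr
      _ ≤ c ^ 3 * r * P.M * (c * (P.t * V)) := by gcongr
      _ = (c ^ 4 * r * P.t * V) * (P.M * 1) := by ring
      _ ≤ (c ^ 4 * r * P.t * V) * (P.M * V ^ 2) := by
          gcongr
          exact one_le_pow₀ hV
  have h5 : L * (b.den : ℝ) ^ 2 ≤ c ^ 4 * r * P.t * V :=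
    le_of_mul_le_mul_right h4 (by positivity)
  have h6 : 2 * P.t / Real.pi * r * (U * V / (b.den : ℝ) ^ 2) * (2 * c ^ 4)
      = 4 * U * (c ^ 4 * r * P.t * V) / (Real.pi * (b.den : ℝ) ^ 2) := by
    field_simp
    ring
  rw [h6, le_div_iff₀ (by positivity)]
  calc 1 * L * (Real.pi * (b.den : ℝ) ^ 2) = Real.pi * (L * (b.den : ℝ) ^ 2) := by ring
    _ ≤ 4 * (L * (b.den : ℝ) ^ 2) := by
        gcongr
        exact Real.pi_le_four
    _ ≤ 4 * U * (c ^ 4 * r * P.t * V) := by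
        have : 0 ≤ L * (b.den : ℝ) ^ 2 := by positivity
        nlinarith

theorem κ_bounds (hc : 1 ≤ c) {j : ℕ} (hj : j ∈ idxIn P b r U₁ U₂ V₁ V₂) :
    (0 : ℝ) < P.u j ∧ U ≤ c * P.u j ∧
      U * V / (b.den : ℝ) ^ 2 ≤ c ^ 2 * P.κ j ∧ P.κ j ≤ U * V / (b.den : ℝ) ^ 2 := by
  obtain ⟨h1, h2, h3, h4⟩ := bounds_of_mem_idxIn hj
  have hU₁ : (0 : ℝ) < U₁ := by exact_mod_cast h.U₁_pos
  have hV₁ : (0 : ℝ) < V₁ := by exact_mod_cast h.V₁_pos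
  have hd : (0 : ℝ) < b.den := by exact_mod_cast b.den_pos
  have hU := h.one_le_U
  have hV := h.one_le_V
  have a1 : U ≤ c * P.u j := h.U_le.trans (by gcongr)
  have a2 : V ≤ c * P.v j := h.V_le.trans (by gcongr)
  have a3 : (P.u j : ℝ) ≤ U := h2.trans h.U₂_le
  have a4 : (P.v j : ℝ) ≤ V := h4.trans h.V₂_le
  refine ⟨hU₁.trans_le h1, a1, ?_, ?_⟩
  · rw [P.κ_eq, d_eq_den hj, mul_div_assoc']
    have h5 : U * V ≤ c ^ 2 * (P.u j * P.v j) := by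
      calc U * V ≤ (c * P.u j) * (c * P.v j) := mul_le_mul a1 a2 (by linarith) (by linarith)
        _ = _ := by ring
    gcongr
  · rw [P.κ_eq, d_eq_den hj]
    gcongr

theorem abs_κ_sub {i j : ℕ} (hi : i ∈ idxIn P b r U₁ U₂ V₁ V₂) (hj : j ∈ idxIn P b r U₁ U₂ V₁ V₂) :
    |P.κ i - P.κ j| / (U * V / (b.den : ℝ) ^ 2)
      = |(P.u i : ℝ) * P.v i - (P.u j : ℝ) * P.v j| / (U * V) := by
  have hd : (0 : ℝ) < b.den := by exact_mod_cast b.den_pos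
  have hU := h.one_le_U
  have hV := h.one_le_V
  rw [P.κ_eq, P.κ_eq, d_eq_den hi, d_eq_den hj, ← sub_div, abs_div,
    abs_of_pos (by positivity : (0 : ℝ) < (b.den : ℝ) ^ 2)]
  field_simp

/-- Identifies the natural scale of the derivative of the phase with `η`, up to an absolute
constant. -/
theorem sqrt_ratio : √(2 * P.t / Real.pi * r * (U * V / (b.den : ℝ) ^ 2) / L)
      / (r * (U * V / (b.den : ℝ) ^ 2)) = √(2 / Real.pi) * eta P b r L U V := by
  have hd : (0 : ℝ) < b.den := by exact_mod_cast b.den_pos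
  have hU := h.one_le_U
  have hV := h.one_le_V
  have hL := h.one_le_L
  have hr : (0 : ℝ) < r := by exact_mod_cast h.r_pos
  have hpi := Real.pi_pos
  have ht := h.t_pos
  rw [eta, ← Real.sqrt_mul (by positivity), div_eq_iff (by positivity)]
  rw [show √(2 / Real.pi * ((b.den : ℝ) ^ 2 * P.t / (r * L * U * V))) * (r * (U * V / (b.den : ℝ) ^ 2))
    = √(2 / Real.pi * ((b.den : ℝ) ^ 2 * P.t / (r * L * U * V)))
      * √((r * (U * V / (b.den : ℝ) ^ 2)) ^ 2) by rw [Real.sqrt_sq (by positivity)],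
    ← Real.sqrt_mul (by positivity)]
  congr 1
  field_simp

end SieveRange
theorem sqrt_two_div_pi_le_one : √(2 / Real.pi) ≤ 1 := by
  rw [Real.sqrt_le_one, div_le_one Real.pi_pos]
  exact Real.two_le_pi

theorem one_le_two_mul_sqrt_two_div_pi : 1 ≤ 2 * √(2 / Real.pi) := by
  have : 1 / 2 ≤ √(2 / Real.pi) := by
    refine Real.le_sqrt_of_sq_le ?_
    rw [le_div_iff₀ Real.pi_pos]
    linarith [Real.pi_le_four]
  linarith

namespace SieveRange

variable {P : Setup} {c : ℝ} {b : ℚ} {r L₁ L₂ U₁ U₂ V₁ V₂ : ℕ} {L U V : ℝ}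
  (h : SieveRange P c b r L₁ L₂ U₁ U₂ V₁ V₂ L U V)

include h

theorem le_mul_of_le (hc : 1 ≤ c) {z : ℝ} (hz : (L₁ : ℝ) ≤ z) : L ≤ 2 * c ^ 2 * z := by
  have h1 := h.L_le
  have h2 : (1 : ℝ) ≤ L₁ := by exact_mod_cast h.L₁_pos
  calc L ≤ c * L₁ := h1
    _ ≤ 2 * c ^ 2 * z := by
      refine mul_le_mul (by nlinarith) hz (by linarith) (by positivity)

/-- The range extends to `L₂ + 1` because the first difference at the last `ℓ` looks one step ahead;
`L ≥ 1` absorbs the extra unit. -/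
theorem le_mul_of_le_add_one (hc : 1 ≤ c) {z : ℝ} (hz : z ≤ ((L₂ + 1 : ℕ) : ℝ)) :
    z ≤ 2 * c ^ 2 * L := by
  have h1 := h.L₂_le
  have h2 := h.one_le_L
  have h3 : 1 ≤ c ^ 2 := one_le_pow₀ hc
  push_cast at hz
  nlinarith

theorem sqrt_ratio_le : √(2 * P.t / Real.pi * r * (U * V / (b.den : ℝ) ^ 2) / L)
    ≤ eta P b r L U V * (r * (U * V / (b.den : ℝ) ^ 2)) := by
  have hsq := h.sqrt_ratio
  have hU := h.one_le_U
  have hV := h.one_le_V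
  have hη := h.eta_pos
  have hr : (0 : ℝ) < r := by exact_mod_cast h.r_pos
  have hd : (0 : ℝ) < b.den := by exact_mod_cast b.den_pos
  rw [div_eq_iff (by positivity)] at hsq
  rw [hsq]
  gcongr
  exact mul_le_of_le_one_left hη.le sqrt_two_div_pi_le_one

/-- The weights attached to an index. -/
theorem isMultiplier_weight (hc : 1 ≤ c) {k σ : ℝ} (hk : 0 ≤ k) (hσ : σ = 1 ∨ σ = -1) {j : ℕ}
    (hj : j ∈ idxIn P b r U₁ U₂ V₁ V₂)
    (hroot : ∀ n : ℕ, L₁ ≤ n → n < L₂ + 1 →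
      rootFactor (2 * P.t / Real.pi * r) (P.κ j) n
        ≤ k * √(2 * P.t / Real.pi * r * (U * V / (b.den : ℝ) ^ 2) / L)) :
    IsMultiplier L₁ (L₂ + 1) (fun n => P.h σ j ((n : ℝ) / r) * P.ω j (P.x σ j ((n : ℝ) / r)))
      (66 * √(c ^ 2 * k * (eta P b r L U V * r * V / U))) := by
  have hU := h.one_le_U
  have hV := h.one_le_V
  have hη := h.eta_pos
  have ht := h.t_pos
  have hr : (0 : ℝ) < r := by exact_mod_cast h.r_pos
  have hd : (0 : ℝ) < b.den := by exact_mod_cast b.den_pos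
  obtain ⟨hu, hUu, -, -⟩ := h.κ_bounds hc hj
  have hsq := h.sqrt_ratio_le
  have hs0 := Real.sqrt_nonneg (2 * P.t / Real.pi * r * (U * V / (b.den : ℝ) ^ 2) / L)
  generalize √(2 * P.t / Real.pi * r * (U * V / (b.den : ℝ) ^ 2) / L) = q at *
  -- The amplitude is at most `(d / u) √s`, whose square is `≪ (d / U)² η r U V / d² = η r V / U`.
  -- The factor `66` is `3 · 22`.
  have m1 := Setup.isMultiplier_h (j := j) (A := L₁) (B := L₂ + 1)
    (W := √(c ^ 2 * k * (eta P b r L U V * r * V / U))) hσ ht hu hr h.L₁_pos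
    (Real.sqrt_nonneg _) ?_
  · have m2 := Setup.isMultiplier_ω_x (j := j) (B := L₂ + 1) h.H_pos hσ ht hu hr h.L₁_pos
    exact (m1.mul m2).mono (by linarith)
  intro n h1 h2
  have h3 := hroot n h1 h2
  refine Real.le_sqrt_of_sq_le ?_
  have h0 : 0 ≤ rootFactor (2 * P.t / Real.pi * r) (P.κ j) n := Real.sqrt_nonneg _
  rw [mul_pow, Real.sq_sqrt h0, d_eq_den hj]
  have h4 : (b.den : ℝ) / P.u j ≤ b.den * c / U := by
    rw [div_le_div_iff₀ hu (by linarith)]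
    nlinarith
  calc ((b.den : ℝ) / P.u j) ^ 2 * rootFactor (2 * P.t / Real.pi * r) (P.κ j) n
      ≤ (b.den * c / U) ^ 2 * (k * (eta P b r L U V * (r * (U * V / (b.den : ℝ) ^ 2)))) := by
        refine mul_le_mul (pow_le_pow_left₀ (by positivity) h4 2)
          (h3.trans (mul_le_mul_of_nonneg_left hsq hk)) h0 (by positivity)
    _ = _ := by field_simp

end SieveRange

/-! ### The sum over `ℓ` attached to a pair of indices. -/

/-- The unweighted sum over `ℓ` that arises from the pair `(i, j)`, with a bound for the factor
that governs the weights. -/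
theorem exists_pair_phase_bound {c : ℝ} (hc : 1 ≤ c) :
    ∃ k : ℝ, 1 ≤ k ∧ ∀ (P : Setup) (b : ℚ) (r L₁ L₂ U₁ U₂ V₁ V₂ : ℕ) (L U V : ℝ),
      SieveRange P c b r L₁ L₂ U₁ U₂ V₁ V₂ L U V → ∀ σ : ℝ, (σ = 1 ∨ σ = -1) →
      ∀ i ∈ idxIn P b r U₁ U₂ V₁ V₂, ∀ j ∈ idxIn P b r U₁ U₂ V₁ V₂, ∀ θ : ℝ,
      (∀ n : ℕ, L₁ ≤ n → n < L₂ + 1 → rootFactor (2 * P.t / Real.pi * r) (P.κ i) n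
        ≤ k * √(2 * P.t / Real.pi * r * (U * V / (b.den : ℝ) ^ 2) / L)) ∧
      ∃ T, 0 ≤ T ∧ T ≤ L ∧ (T ≤ cutoff P b r L U V ∨
          (distInt θ * T ^ 2 ≤ 2 * k * L ∧
            |(P.u i : ℝ) * P.v i - (P.u j : ℝ) * P.v j| / (U * V) * eta P b r L U V * T ^ 2
              ≤ 2 * L)) ∧
        ∀ B ≤ L₂ + 1, ‖∑ l ∈ Finset.Ico L₁ B,
            e (θ * l + (P.g σ i ((l : ℝ) / r) - P.g σ j ((l : ℝ) / r)))‖ ≤ 40 * k ^ 2 * T := by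
  have hc2 : 1 ≤ c ^ 2 := one_le_pow₀ hc
  obtain ⟨k, hk, hphase⟩ := exists_phaseDeriv_bounds (m₀ := 1 / (2 * c ^ 4)) (C₀ := 2 * c ^ 2)
    (by positivity) (by linarith)
  refine ⟨k, hk, ?_⟩
  intro P b r L₁ L₂ U₁ U₂ V₁ V₂ L U V h σ hσ i hi j hj θ
  have hL := h.one_le_L
  have hU := h.one_le_U
  have hV := h.one_le_V
  have hη := h.eta_pos
  have ht := h.t_pos
  have hpi := Real.pi_pos
  have hr : (0 : ℝ) < r := by exact_mod_cast h.r_pos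
  have hd : (0 : ℝ) < b.den := by exact_mod_cast b.den_pos
  obtain ⟨hui, -, hκi, hκi'⟩ := h.κ_bounds hc hi
  obtain ⟨huj, -, hκj, hκj'⟩ := h.κ_bounds hc hj
  have hκi0 := Setup.κ_pos hui
  have hκj0 := Setup.κ_pos huj
  have habs := h.abs_κ_sub hi hj
  have hsq := h.sqrt_ratio
  have hratio := h.le_ratio hc
  have hK₀ : 0 < U * V / (b.den : ℝ) ^ 2 := by positivity
  have hb : 0 < 2 * P.t / Real.pi * r := by positivity
  have hκi2 : U * V / (b.den : ℝ) ^ 2 ≤ 2 * c ^ 2 * P.κ i := by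
    have : 0 ≤ c ^ 2 * P.κ i := by positivity
    linarith
  have hκj2 : U * V / (b.den : ℝ) ^ 2 ≤ 2 * c ^ 2 * P.κ j := by
    have : 0 ≤ c ^ 2 * P.κ j := by positivity
    linarith
  obtain ⟨hfirst, ε, hε, hsecond⟩ := hphase (2 * P.t / Real.pi * r) r σ (U * V / (b.den : ℝ) ^ 2) L
    (P.κ i) (P.κ j) hσ hb hr hK₀ (by linarith) hratio hκi2 hκi' hκj2 hκj'
  have hδ1 : |P.κ i - P.κ j| / (U * V / (b.den : ℝ) ^ 2) ≤ 1 := by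
    rw [div_le_one hK₀, abs_le]
    constructor <;> linarith
  have hδ0 : 0 ≤ |P.κ i - P.κ j| / (U * V / (b.den : ℝ) ^ 2) := by positivity
  have hτ0 : 0 < √(2 / Real.pi) * eta P b r L U V :=
    mul_pos (Real.sqrt_pos.2 (by positivity)) hη
  have hτη : √(2 / Real.pi) * eta P b r L U V ≤ eta P b r L U V :=
    mul_le_of_le_one_left hη.le sqrt_two_div_pi_le_one
  have hητ : eta P b r L U V ≤ 2 * (√(2 / Real.pi) * eta P b r L U V) := by
    have := mul_le_mul_of_nonneg_right one_le_two_mul_sqrt_two_div_pi hη.le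
    linarith
  rw [hsq] at hfirst hsecond
  rw [habs] at hδ0 hδ1 hfirst hsecond
  clear hsq habs hratio hphase
  refine ⟨fun n h1 h2 => (hfirst n (h.le_mul_of_le hc (by exact_mod_cast h1))
    (h.le_mul_of_le_add_one hc (by exact_mod_cast h2.le))).1, ?_⟩
  have hL₁ : (0 : ℝ) < L₁ := by exact_mod_cast h.L₁_pos
  have hcard : ((L₂ + 1 : ℕ) : ℝ) - L₁ ≤ L := by
    have h1 : (1 : ℝ) ≤ L₁ := by exact_mod_cast h.L₁_pos
    have h2 := h.L₂_le
    push_cast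
    linarith
  have hσ2 : σ ^ 2 = 1 := by rcases hσ with rfl | rfl <;> norm_num
  have hσ1 : |σ| = 1 := by rcases hσ with rfl | rfl <;> norm_num
  -- The derivative of the full phase is `θ - σ * phaseDeriv`, so the sign of its growth is `-σ ε`.
  have hsep : ∀ x ∈ Set.Icc (L₁ : ℝ) (L₂ + 1 : ℕ), ∀ y ∈ Set.Icc (L₁ : ℝ) (L₂ + 1 : ℕ), x ≤ y →
      |(P.u i : ℝ) * P.v i - (P.u j : ℝ) * P.v j| / (U * V)
        * (√(2 / Real.pi) * eta P b r L U V) / (k * L) * (y - x) ≤ -σ * ε *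
        ((θ - σ * phaseDeriv (2 * P.t / Real.pi * r) r σ (P.κ i) (P.κ j) y)
          - (θ - σ * phaseDeriv (2 * P.t / Real.pi * r) r σ (P.κ i) (P.κ j) x)) := by
    intro x hx y hy hxy
    have := hsecond x y (h.le_mul_of_le hc hx.1) hxy (h.le_mul_of_le_add_one hc hy.2)
    refine this.trans_eq ?_
    linear_combination (-ε * (phaseDeriv (2 * P.t / Real.pi * r) r σ (P.κ i) (P.κ j) y
      - phaseDeriv (2 * P.t / Real.pi * r) r σ (P.κ i) (P.κ j) x)) * hσ2
  have hρ : ∀ z ∈ Set.Icc (L₁ : ℝ) (L₂ + 1 : ℕ),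
      |θ - σ * phaseDeriv (2 * P.t / Real.pi * r) r σ (P.κ i) (P.κ j) z - θ| ≤
        k * (|(P.u i : ℝ) * P.v i - (P.u j : ℝ) * P.v j| / (U * V)
          * (√(2 / Real.pi) * eta P b r L U V)) := by
    intro z hz
    have := (hfirst z (h.le_mul_of_le hc hz.1) (h.le_mul_of_le_add_one hc hz.2)).2
    rwa [sub_sub_cancel_left, abs_neg, abs_mul, hσ1, one_mul]
  obtain ⟨T, hT0, hTL, hT, hsum⟩ := exists_sum_bound_of_phase hk hL hτ0 hδ0 hδ1
    (by rcases hσ with rfl | rfl <;> rcases hε with rfl | rfl <;> norm_num)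
    (fun z hz => Setup.hasDerivAt_phase_sub hσ ht hui huj hr θ (hL₁.trans_le hz.1))
    hsep hρ hcard
  refine ⟨T, hT0, hTL, ?_, hsum⟩
  rcases hT with hT | hT
  · exact Or.inl (hT.trans (Real.sqrt_le_sqrt
      (mul_le_mul_of_nonneg_left (max_le_max_right _ hτη) (by linarith))))
  · refine Or.inr ⟨hT.1, ?_⟩
    have h1 := mul_le_mul_of_nonneg_right (mul_le_mul_of_nonneg_left hητ hδ0) (sq_nonneg T)
    linarith [hT.2]

/-- The sum over `ℓ` that arises from the pair `(i, j)` after Cauchy's inequality. -/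
theorem exists_pair_sum_bound {c : ℝ} (hc : 1 ≤ c) :
    ∃ K : ℝ, 1 ≤ K ∧ ∀ (P : Setup) (b : ℚ) (r L₁ L₂ U₁ U₂ V₁ V₂ : ℕ) (L U V : ℝ),
      SieveRange P c b r L₁ L₂ U₁ U₂ V₁ V₂ L U V → ∀ σ : ℝ, (σ = 1 ∨ σ = -1) →
      ∀ i ∈ idxIn P b r U₁ U₂ V₁ V₂, ∀ j ∈ idxIn P b r U₁ U₂ V₁ V₂, ∀ θ : ℝ,
      ∃ T, 0 ≤ T ∧ T ≤ L ∧ (T ≤ cutoff P b r L U V ∨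
          (distInt θ * T ^ 2 ≤ K * L ∧
            |(P.u i : ℝ) * P.v i - (P.u j : ℝ) * P.v j| / (U * V) * eta P b r L U V * T ^ 2
              ≤ K * L)) ∧
        ‖∑ l ∈ Finset.Icc L₁ L₂,
            ((P.h σ i ((l : ℝ) / r) * P.ω i (P.x σ i ((l : ℝ) / r)) *
              (P.h σ j ((l : ℝ) / r) * P.ω j (P.x σ j ((l : ℝ) / r))) : ℝ) : ℂ)
            * e (θ * l + (P.g σ i ((l : ℝ) / r) - P.g σ j ((l : ℝ) / r)))‖
          ≤ K * (eta P b r L U V * r * V / U) * T := by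
  obtain ⟨k, hk, hphase⟩ := exists_pair_phase_bound hc
  have hc2 : 1 ≤ c ^ 2 := one_le_pow₀ hc
  have hk2 : 1 ≤ k ^ 2 := one_le_pow₀ hk
  have hck : 1 ≤ c ^ 2 * k ^ 2 := one_le_mul_of_one_le_of_one_le hc2 hk2
  have hk3 : k ≤ c ^ 2 * k ^ 2 * k := le_mul_of_one_le_left (by linarith) hck
  -- `174240 = 40 · 66²`: the unweighted bound contributes `40 k²`, and the weights of the two
  -- indices contribute `66² c² k`.
  refine ⟨174240 * (c ^ 2 * k ^ 2 * k), by linarith, ?_⟩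
  intro P b r L₁ L₂ U₁ U₂ V₁ V₂ L U V h σ hσ i hi j hj θ
  have hL := h.one_le_L
  have hU := h.one_le_U
  have hV := h.one_le_V
  have hη := h.eta_pos
  have hr : (0 : ℝ) < r := by exact_mod_cast h.r_pos
  obtain ⟨hri, T, hT0, hTL, hT, hsum⟩ := hphase P b r L₁ L₂ U₁ U₂ V₁ V₂ L U V h σ hσ i hi j hj θ
  obtain ⟨hrj, -⟩ := hphase P b r L₁ L₂ U₁ U₂ V₁ V₂ L U V h σ hσ j hj i hi θ
  have hE0 : 0 < eta P b r L U V * r * V / U := by positivity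
  refine ⟨T, hT0, hTL, ?_, ?_⟩
  · refine hT.imp id fun hT => ⟨hT.1.trans ?_, hT.2.trans ?_⟩ <;>
      exact mul_le_mul_of_nonneg_right (by linarith) (by linarith)
  · have hfinal := ((h.isMultiplier_weight hc (by linarith) hσ hi hri).mul
      (h.isMultiplier_weight hc (by linarith) hσ hj hrj)) _ _ hsum (L₂ + 1) le_rfl
    have hIco : Finset.Ico L₁ (L₂ + 1) = Finset.Icc L₁ L₂ := by ext; simp
    rw [hIco] at hfinal
    refine hfinal.trans (le_of_eq ?_)
    generalize eta P b r L U V * r * V / U = E at *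
    have hs : √(c ^ 2 * k * E) * √(c ^ 2 * k * E) = c ^ 2 * k * E :=
      Real.mul_self_sqrt (by positivity)
    linear_combination (174240 * k ^ 2 * T) * hs

/-! ### Cauchy's inequality and the passage to an integral. -/

theorem sum_norm_sq_le (I S : Finset ℕ) (z : ℕ → ℕ → ℂ) :
    ∑ l ∈ S, ‖∑ j ∈ I, z j l‖ ^ 2
      ≤ ∑ w ∈ I ×ˢ I, ‖∑ l ∈ S, z w.1 l * (starRingEnd ℂ) (z w.2 l)‖ := by
  have h : ((∑ l ∈ S, ‖∑ j ∈ I, z j l‖ ^ 2 : ℝ) : ℂ)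
      = ∑ w ∈ I ×ˢ I, ∑ l ∈ S, z w.1 l * (starRingEnd ℂ) (z w.2 l) := by
    rw [Finset.sum_comm]
    push_cast
    refine Finset.sum_congr rfl fun l _ => ?_
    rw [← Complex.mul_conj', map_sum, Finset.sum_mul_sum, Finset.sum_product]
  have h0 : 0 ≤ ∑ l ∈ S, ‖∑ j ∈ I, z j l‖ ^ 2 := by positivity
  rw [← abs_of_nonneg h0, ← Real.norm_eq_abs, ← Complex.norm_real, h]
  exact norm_sum_le _ _

theorem norm_sum_mul_sum_sq_le (I S : Finset ℕ) (lam : ℕ → ℂ) (z : ℕ → ℕ → ℂ) :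
    ‖∑ l ∈ S, lam l * ∑ j ∈ I, z j l‖ ^ 2 ≤ (∑ l ∈ S, ‖lam l‖ ^ 2) *
      ∑ w ∈ I ×ˢ I, ‖∑ l ∈ S, z w.1 l * (starRingEnd ℂ) (z w.2 l)‖ := by
  have h1 : ‖∑ l ∈ S, lam l * ∑ j ∈ I, z j l‖ ≤ ∑ l ∈ S, ‖lam l‖ * ‖∑ j ∈ I, z j l‖ :=
    (norm_sum_le _ _).trans_eq (by simp only [norm_mul])
  calc _ ≤ (∑ l ∈ S, ‖lam l‖ * ‖∑ j ∈ I, z j l‖) ^ 2 := pow_le_pow_left₀ (norm_nonneg _) h1 2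
    _ ≤ (∑ l ∈ S, ‖lam l‖ ^ 2) * ∑ l ∈ S, ‖∑ j ∈ I, z j l‖ ^ 2 :=
        Finset.sum_mul_sq_le_sq_mul_sq _ _ _
    _ ≤ _ := by
        gcongr
        exact sum_norm_sq_le I S z

/-- If `T > X₀`, the integrand equals `1` on `[X₀, T]`. If `X₀ > L`, the oriented integral is
negative but at least `L - X₀` since `f ≤ 1`, and `T ≤ L` suffices. -/
theorem le_add_integral_of_antitoneOn {f : ℝ → ℝ} (hf : AntitoneOn f (Set.Ioi 0))
    (hf0 : ∀ X, 0 ≤ f X) (hf1 : ∀ X, f X ≤ 1) {X₀ L T : ℝ} (hX₀ : 0 < X₀) (hL : 0 < L)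
    (hTL : T ≤ L) (hT : T ≤ X₀ ∨ ∀ X, 0 < X → X ≤ T → f X = 1) :
    T ≤ X₀ + ∫ X in X₀..L, f X := by
  have hint : ∀ x y : ℝ, 0 < x → 0 < y → IntervalIntegrable f MeasureTheory.volume x y :=
    fun x y hx hy => (hf.mono fun z hz => (lt_min hx hy).trans_le hz.1).intervalIntegrable
  rcases le_or_gt X₀ L with h | h
  · rcases le_or_gt T X₀ with h' | h'
    · have := intervalIntegral.integral_nonneg (μ := MeasureTheory.volume) h fun X _ => hf0 X
      linarith
    · have hT' := hT.resolve_left (not_le.2 h')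
      have hT0 : 0 < T := hX₀.trans h'
      have e1 := intervalIntegral.integral_add_adjacent_intervals (hint X₀ T hX₀ hT0)
        (hint T L hT0 hL)
      have e2 : ∫ X in X₀..T, f X = T - X₀ := by
        rw [intervalIntegral.integral_congr (g := fun _ => (1 : ℝ)) fun X hX => ?_]
        · simp
        · rw [Set.uIcc_of_le h'.le] at hX
          exact hT' X (hX₀.trans_le hX.1) hX.2
      have e3 := intervalIntegral.integral_nonneg (μ := MeasureTheory.volume) hTL fun X _ => hf0 X
      linarith
  · have e1 : ∫ X in L..X₀, f X ≤ ∫ _ in L..X₀, (1 : ℝ) :=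
      intervalIntegral.integral_mono_on h.le (hint L X₀ hL hX₀) (by simp) fun X _ => hf1 X
    rw [intervalIntegral.integral_symm]
    simp only [intervalIntegral.integral_const, smul_eq_mul, mul_one] at e1
    linarith

theorem norm_mul_norm_le_iSup {s : Finset ℕ} (ν : ℕ → ℂ) {i j : ℕ} (hi : i ∈ s) (hj : j ∈ s) :
    ‖ν i‖ * ‖ν j‖ ≤ ⨆ k : s, ‖ν k‖ ^ 2 := by
  have hb : BddAbove (Set.range fun k : s => ‖ν k‖ ^ 2) := (Set.finite_range _).bddAbove
  have h1 : ‖ν i‖ ^ 2 ≤ ⨆ k : s, ‖ν k‖ ^ 2 := le_ciSup hb ⟨i, hi⟩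
  have h2 : ‖ν j‖ ^ 2 ≤ ⨆ k : s, ‖ν k‖ ^ 2 := le_ciSup hb ⟨j, hj⟩
  nlinarith [sq_nonneg (‖ν i‖ - ‖ν j‖)]

theorem flat_pos {N : ℕ} (hN : 1 ≤ N) : 0 < flat N :=
  Nat.div_pos (Nat.le_of_dvd hN (Nat.prod_primeFactors_dvd N))
    (Finset.prod_pos fun _ hp => Nat.pos_of_mem_primeFactors hp)

theorem norm_term_sum (S : Finset ℕ) (ν₁ ν₂ : ℂ) (θ₁ θ₂ : ℝ) (h₁ h₂ w₁ w₂ g₁ g₂ : ℕ → ℝ) :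
    ‖∑ l ∈ S, (ν₁ * e (θ₁ * l) * (h₁ l : ℂ) * (w₁ l : ℂ) * e (g₁ l)) *
        (starRingEnd ℂ) (ν₂ * e (θ₂ * l) * (h₂ l : ℂ) * (w₂ l : ℂ) * e (g₂ l))‖
      = ‖ν₁‖ * ‖ν₂‖ * ‖∑ l ∈ S, ((h₁ l * w₁ l * (h₂ l * w₂ l) : ℝ) : ℂ)
          * e ((θ₁ - θ₂) * l + (g₁ l - g₂ l))‖ := by
  have : ∀ l ∈ S, (ν₁ * e (θ₁ * l) * (h₁ l : ℂ) * (w₁ l : ℂ) * e (g₁ l)) *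
        (starRingEnd ℂ) (ν₂ * e (θ₂ * l) * (h₂ l : ℂ) * (w₂ l : ℂ) * e (g₂ l))
      = ν₁ * (starRingEnd ℂ) ν₂ * (((h₁ l * w₁ l * (h₂ l * w₂ l) : ℝ) : ℂ)
          * e ((θ₁ - θ₂) * l + (g₁ l - g₂ l))) := by
    intro l _
    rw [show (θ₁ - θ₂) * l + (g₁ l - g₂ l) = θ₁ * l + (-(θ₂ * l) + (g₁ l + -g₂ l)) by ring,
      e_add, e_add, e_add, ← conj_e, ← conj_e]
    simp only [map_mul, Complex.conj_ofReal]
    push_cast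
    ring
  rw [Finset.sum_congr rfl this, ← Finset.mul_sum, norm_mul, norm_mul, Complex.norm_conj]

theorem Setup.Standing.sieveRange {P : Setup} {c : ℝ} (hP : P.Standing c 1) {b : ℚ}
    {r L₁ L₂ U₁ U₂ V₁ V₂ : ℕ} {L U V : ℝ} (hr : r ∣ P.N * flat P.N) (hL₁ : 0 < L₁) (hU₁ : 0 < U₁)
    (hV₁ : 0 < V₁) (hL : L ≤ c * L₁) (hL₁₂ : L₁ ≤ L₂) (hL₂ : (L₂ : ℝ) ≤ L) (hU : U ≤ c * U₁)
    (hU₁₂ : U₁ ≤ U₂) (hU₂ : (U₂ : ℝ) ≤ U) (hV : V ≤ c * V₁) (hV₁₂ : V₁ ≤ V₂) (hV₂ : (V₂ : ℝ) ≤ V)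
    (hLM : L ≤ c * (r * P.M / ((b.den : ℝ) * P.R) ^ 2)) (hVR : V ≤ c * P.R)
    (hUV : U ≤ c * (P.t * V / P.M)) : SieveRange P c b r L₁ L₂ U₁ U₂ V₁ V₂ L U V := by
  have hM₀ : (0 : ℝ) < P.M₀ := by exact_mod_cast (show 0 < 2 by norm_num).trans_le hP.two_le_M₀
  have hM : 0 < P.M := hM₀.trans_le hP.M₀_le_M
  exact
    { t_pos := one_pos.trans_le hP.t_ge
      M_pos := hM
      R_pos := Real.sqrt_pos.2 (div_pos hM hM₀)
      r_pos := Nat.pos_of_dvd_of_pos hr (Nat.mul_pos hP.N_pos (flat_pos hP.N_pos))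
      L₁_pos := hL₁
      U₁_pos := hU₁
      V₁_pos := hV₁
      L_le := hL
      L₁_le := hL₁₂
      L₂_le := hL₂
      U_le := hU
      U₁_le := hU₁₂
      U₂_le := hU₂
      V_le := hV
      V₁_le := hV₁₂
      V₂_le := hV₂
      L_le_mul := hLM
      V_le_mul := hVR
      U_le_mul := hUV }

/-! ### Counting pairs by indicator functions. -/

open Classical in
/-- The indicator function of the condition that is counted by `pairCount`. -/
def pairIndicator (P : Setup) (r : ℕ) (U V : ℝ) (Δ₁ Δ₂ : ℝ → ℝ) (w : ℕ × ℕ) (X : ℝ) : ℝ :=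
  if distInt (P.invFrac r w.1 - P.invFrac r w.2) ≤ Δ₁ X ∧
    |(P.u w.1 : ℝ) * P.v w.1 - (P.u w.2 : ℝ) * P.v w.2| ≤ U * V * Δ₂ X then 1 else 0

section PairIndicator

variable {P : Setup} {r : ℕ} {U V : ℝ} {Δ₁ Δ₂ : ℝ → ℝ} {w : ℕ × ℕ}

theorem pairIndicator_nonneg (X : ℝ) : 0 ≤ pairIndicator P r U V Δ₁ Δ₂ w X := by
  rw [pairIndicator]; split_ifs <;> norm_num

theorem pairIndicator_le_one (X : ℝ) : pairIndicator P r U V Δ₁ Δ₂ w X ≤ 1 := by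
  rw [pairIndicator]; split_ifs <;> norm_num

/-- Both thresholds shrink as `X` grows, so a pair that is counted at `Y` is counted at every
smaller positive `X`. Monotonicity also provides integrability. -/
theorem pairIndicator_antitoneOn (hUV : 0 ≤ U * V) (h₁ : AntitoneOn Δ₁ (Set.Ioi 0))
    (h₂ : AntitoneOn Δ₂ (Set.Ioi 0)) :
    AntitoneOn (pairIndicator P r U V Δ₁ Δ₂ w) (Set.Ioi 0) := by
  intro X hX Y hY hXY
  by_cases h : distInt (P.invFrac r w.1 - P.invFrac r w.2) ≤ Δ₁ Y ∧
    |(P.u w.1 : ℝ) * P.v w.1 - (P.u w.2 : ℝ) * P.v w.2| ≤ U * V * Δ₂ Y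
  · have h' : distInt (P.invFrac r w.1 - P.invFrac r w.2) ≤ Δ₁ X ∧
        |(P.u w.1 : ℝ) * P.v w.1 - (P.u w.2 : ℝ) * P.v w.2| ≤ U * V * Δ₂ X :=
      ⟨h.1.trans (h₁ hX hY hXY), h.2.trans (mul_le_mul_of_nonneg_left (h₂ hX hY hXY) hUV)⟩
    rw [pairIndicator, pairIndicator, if_pos h, if_pos h']
  · rw [pairIndicator, if_neg h]
    exact pairIndicator_nonneg X

theorem pairCount_eq_sum (b : ℚ) (U₁ U₂ V₁ V₂ : ℕ) (X : ℝ) :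
    (pairCount P b r U₁ U₂ V₁ V₂ U V (Δ₁ X) (Δ₂ X) : ℝ)
      = ∑ w ∈ idxIn P b r U₁ U₂ V₁ V₂ ×ˢ idxIn P b r U₁ U₂ V₁ V₂,
          pairIndicator P r U V Δ₁ Δ₂ w X := by
  simp only [pairCount, pairIndicator, Finset.card_filter]
  push_cast
  rfl

end PairIndicator

end FareySieve

end

/-! ### The large sieve inequality. -/

open FareySieve in
theorem mainTheorem5 (c : ℝ) (hc : 1 ≤ c) :
    ∃ t₀ C : ℝ, 0 < C ∧
      ∀ P : Setup, P.Standing c t₀ →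
      ∀ β ∈ badFractions P.N, ∀ r : ℕ, r ∣ P.N * flat P.N →
      ∀ L₁ L₂ U₁ U₂ V₁ V₂ : ℕ, ∀ L U V : ℝ,
        0 < L₁ → 0 < U₁ → 0 < V₁ →
        L ≤ c * L₁ → L₁ ≤ L₂ → (L₂ : ℝ) ≤ L →
        U ≤ c * U₁ → U₁ ≤ U₂ → (U₂ : ℝ) ≤ U →
        V ≤ c * V₁ → V₁ ≤ V₂ → (V₂ : ℝ) ≤ V →
        L ≤ c * (r * P.M / ((β.den : ℝ) * P.R) ^ 2) →
        V ≤ c * P.R →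
        U ≤ c * (P.t * V / P.M) → P.t * V / P.M ≤ c * U →
      ∃ Δ₁ Δ₂ : ℝ → ℝ,
        (∀ X : ℝ, 0 < X →
          0 ≤ Δ₁ X ∧ Δ₁ X ≤ C * (L / X ^ 2) ∧
          0 ≤ Δ₂ X ∧ Δ₂ X ≤ C * (L / (eta P β r L U V * X ^ 2))) ∧
        IntervalIntegrable
          (fun X => (pairCount P β r U₁ U₂ V₁ V₂ U V (Δ₁ X) (Δ₂ X) : ℝ))
          MeasureTheory.volume (cutoff P β r L U V) L ∧
        ∀ σ : ℝ, (σ = 1 ∨ σ = -1) → ∀ lam ν : ℕ → ℂ,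
          ‖∑ l ∈ Finset.Icc L₁ L₂, lam l *
              ∑ j ∈ idxIn P β r U₁ U₂ V₁ V₂,
                ν j * e (P.invFrac r j * l) * (P.h σ j ((l : ℝ) / r) : ℂ)
                  * (P.ω j (P.x σ j ((l : ℝ) / r)) : ℂ) * e (P.g σ j ((l : ℝ) / r))‖ ^ 2
            ≤ C * (⨆ j : P.idx β r, ‖ν j‖ ^ 2) * (∑ l ∈ Finset.Icc L₁ L₂, ‖lam l‖ ^ 2)
              * (eta P β r L U V * r * V / U)
              * (cutoff P β r L U V * ((pairs β U₁ U₂ V₁ V₂).card : ℝ) ^ 2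
                + ∫ X in (cutoff P β r L U V)..L,
                    (pairCount P β r U₁ U₂ V₁ V₂ U V (Δ₁ X) (Δ₂ X) : ℝ)) := by
  obtain ⟨K, hK, hpair⟩ := exists_pair_sum_bound hc
  -- The lower bound for `t` serves only to make `t` positive, so `t₀ = 1` suffices.
  refine ⟨1, K, by linarith, ?_⟩
  intro P hP b _ r hr L₁ L₂ U₁ U₂ V₁ V₂ L U V hL₁ hU₁ hV₁ hL hL₁₂ hL₂ hU hU₁₂ hU₂ hV hV₁₂ hV₂ hLM hVR
    hUV _
  have h : SieveRange P c b r L₁ L₂ U₁ U₂ V₁ V₂ L U V :=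
    hP.sieveRange hr hL₁ hU₁ hV₁ hL hL₁₂ hL₂ hU hU₁₂ hU₂ hV hV₁₂ hV₂ hLM hVR hUV
  have hL1 := h.one_le_L
  have hU1 := h.one_le_U
  have hV1 := h.one_le_V
  have hη := h.eta_pos
  have hr0 : (0 : ℝ) < r := by exact_mod_cast h.r_pos
  have hUV0 : 0 < U * V := by positivity
  set η := eta P b r L U V
  have hX₀ : 0 < cutoff P b r L U V := by
    refine Real.sqrt_pos.2 (mul_pos (by linarith) ?_)
    exact lt_max_of_lt_right one_pos
  set X₀ := cutoff P b r L U V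
  -- With the constant `K` of the pair bound, its inequalities `‖θ‖ T² ≤ K L` and `δ η T² ≤ K L`
  -- become the counting conditions at `X = T`.
  set Δ₁ : ℝ → ℝ := fun X => K * (L / X ^ 2) with hΔ₁
  set Δ₂ : ℝ → ℝ := fun X => K * (L / (η * X ^ 2)) with hΔ₂
  have hanti₁ : AntitoneOn Δ₁ (Set.Ioi 0) := by
    intro X hX Y hY hXY
    rw [Set.mem_Ioi] at hX
    simp only [hΔ₁]
    gcongr
  have hanti₂ : AntitoneOn Δ₂ (Set.Ioi 0) := by
    intro X hX Y hY hXY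
    rw [Set.mem_Ioi] at hX
    simp only [hΔ₂]
    gcongr
  have hint : ∀ w, IntervalIntegrable (pairIndicator P r U V Δ₁ Δ₂ w) MeasureTheory.volume X₀ L :=
    fun w => ((pairIndicator_antitoneOn hUV0.le hanti₁ hanti₂).mono fun z hz =>
      (lt_min hX₀ (by linarith)).trans_le hz.1).intervalIntegrable
  set I := idxIn P b r U₁ U₂ V₁ V₂ with hI
  refine ⟨Δ₁, Δ₂, fun X hX => ⟨by positivity, le_rfl, by positivity, le_rfl⟩, ?_, ?_⟩
  · simp only [pairCount_eq_sum]
    have := IntervalIntegrable.sum (I ×ˢ I) fun w _ => hint w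
    simpa only [Finset.sum_fn] using this
  intro σ hσ lam ν
  set E := η * r * V / U with hE
  have hE0 : 0 < E := by positivity
  set ν₀ := ⨆ j : P.idx b r, ‖ν j‖ ^ 2 with hν₀
  have hν₀0 : 0 ≤ ν₀ := Real.iSup_nonneg fun j => by positivity
  set Λ := ∑ l ∈ Finset.Icc L₁ L₂, ‖lam l‖ ^ 2
  have hΛ0 : 0 ≤ Λ := by positivity
  have hterm : ∀ w ∈ I ×ˢ I,
      ‖∑ l ∈ Finset.Icc L₁ L₂,
        (ν w.1 * e (P.invFrac r w.1 * l) * (P.h σ w.1 ((l : ℝ) / r) : ℂ)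
          * (P.ω w.1 (P.x σ w.1 ((l : ℝ) / r)) : ℂ) * e (P.g σ w.1 ((l : ℝ) / r))) *
        (starRingEnd ℂ) (ν w.2 * e (P.invFrac r w.2 * l) * (P.h σ w.2 ((l : ℝ) / r) : ℂ)
          * (P.ω w.2 (P.x σ w.2 ((l : ℝ) / r)) : ℂ) * e (P.g σ w.2 ((l : ℝ) / r)))‖
      ≤ ν₀ * (K * E) * (X₀ + ∫ X in X₀..L, pairIndicator P r U V Δ₁ Δ₂ w X) := by
    rintro ⟨i, j⟩ hw
    obtain ⟨hi, hj⟩ := Finset.mem_product.1 hw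
    obtain ⟨T, hT0, hTL, hT, hsum⟩ := hpair P b r L₁ L₂ U₁ U₂ V₁ V₂ L U V h σ hσ i hi j hj
      (P.invFrac r i - P.invFrac r j)
    have hTint : T ≤ X₀ + ∫ X in X₀..L, pairIndicator P r U V Δ₁ Δ₂ (i, j) X := by
      refine le_add_integral_of_antitoneOn (pairIndicator_antitoneOn hUV0.le hanti₁ hanti₂)
        pairIndicator_nonneg pairIndicator_le_one hX₀ (by linarith) hTL (hT.imp id ?_)
      rintro ⟨h1, h2⟩ X hX hXT
      have hXT2 : X ^ 2 ≤ T ^ 2 := pow_le_pow_left₀ hX.le hXT 2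
      refine if_pos ⟨?_, ?_⟩
      · simp only [hΔ₁]
        rw [mul_div_assoc', le_div_iff₀ (by positivity)]
        exact (mul_le_mul_of_nonneg_left hXT2 (abs_nonneg _)).trans h1
      · simp only [hΔ₂]
        rw [← div_le_iff₀' hUV0, mul_div_assoc', le_div_iff₀ (by positivity), ← mul_assoc]
        exact (mul_le_mul_of_nonneg_left hXT2 (by positivity)).trans h2
    rw [norm_term_sum (Finset.Icc L₁ L₂) (ν i) (ν j) (P.invFrac r i) (P.invFrac r j)
      (fun l => P.h σ i ((l : ℝ) / r)) (fun l => P.h σ j ((l : ℝ) / r))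
      (fun l => P.ω i (P.x σ i ((l : ℝ) / r))) (fun l => P.ω j (P.x σ j ((l : ℝ) / r)))
      (fun l => P.g σ i ((l : ℝ) / r)) (fun l => P.g σ j ((l : ℝ) / r))]
    have hν := norm_mul_norm_le_iSup ν (mem_idx_of_mem_idxIn hi) (mem_idx_of_mem_idxIn hj)
    calc _ ≤ ν₀ * (K * E * T) := by gcongr
      _ = ν₀ * (K * E) * T := by ring
      _ ≤ _ := by gcongr
  refine (norm_sum_mul_sum_sq_le I (Finset.Icc L₁ L₂) lam _).trans ?_
  have hcard : ((I.card : ℕ) : ℝ) ≤ ((pairs b U₁ U₂ V₁ V₂).card : ℝ) := by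
    exact_mod_cast card_idxIn_le
  have hcount : ∫ X in X₀..L, (pairCount P b r U₁ U₂ V₁ V₂ U V (Δ₁ X) (Δ₂ X) : ℝ)
      = ∑ w ∈ I ×ˢ I, ∫ X in X₀..L, pairIndicator P r U V Δ₁ Δ₂ w X := by
    simp only [pairCount_eq_sum]
    exact intervalIntegral.integral_finsetSum fun w _ => hint w
  rw [hcount]
  calc _ ≤ Λ * ∑ w ∈ I ×ˢ I,
        ν₀ * (K * E) * (X₀ + ∫ X in X₀..L, pairIndicator P r U V Δ₁ Δ₂ w X) := by
        refine mul_le_mul_of_nonneg_left (Finset.sum_le_sum hterm) hΛ0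
    _ = K * ν₀ * Λ * E * (X₀ * (I.card : ℝ) ^ 2
          + ∑ w ∈ I ×ˢ I, ∫ X in X₀..L, pairIndicator P r U V Δ₁ Δ₂ w X) := by
        rw [← Finset.mul_sum, Finset.sum_add_distrib, Finset.sum_const, Finset.card_product,
          nsmul_eq_mul]
        push_cast
        ring
    _ ≤ _ := by gcongr
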